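/- Let $\lambda>0$, $c_1>0$, and let $f$ be a probability density on $[0,\infty)$ with tail $\bar F(x)=\int_x^\infty f(y)\,dy$. Consider the classical risk process $U(t)=u+c_1t-\sum_{i=1}^{N_t}X_i$ with initial capital $u\ge 0$, where $X_1,X_2,\dots$ are i.i.d. with density $f$ and $(N_t)_{t\ge0}$ is an independent Poisson process of rate $\lambda$. Let $\tau=\inf\{t>0: U(t)<0\}$ (with $\inf\emptyset=\infty$). Let $f^{1*}=f$ and $f^{(n+1)*}=f^{n*}*f$, where $(g*h)(t)=\int_0^t g(x)h(t-x)\,dx$, and put $$g_1(x,0,t)=\delta_{x/c_1}(t)\,e^{-\lambda x/c_1},\qquad g_1(x,n,t)=\frac{x\,t^{n-1}e^{-\lambda t}\lambda^n}{n!}\,f^{n*}(c_1t-x)\quad(n\ge1),$$ where $\delta_{x/c_1}$ is the unit impulse in the variable $t$ at $x/c_1$, so that $\int_0^{c_1t}h(x)\,g_1(x,0,t)\,dx=c_1\,h(c_1t)\,e^{-\lambda t}$. Then for every $u\ge0$ and $n\ge1$ the joint density $w_\infty(u,n,t)=P(N_\tau=n,\ \tau\in dt\mid U(0)=u)/dt$,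 $t>0$, exists, and the following identities hold for almost every $t>0$ (all integrals being absolutely convergent). For every $u\ge 0$, $$w_\infty(u,1,t)=\lambda e^{-\lambda t}\bar F(u+c_1t),$$ and for every $u\ge0$ and $n\ge1$, $$w_\infty(u,n+1,t)=\frac{(\lambda t)^n}{n!}e^{-\lambda t}\int_0^{u+c_1t}f^{n*}(u+c_1t-x)\,\lambda\bar F(x)\,dx-c_1\sum_{j=1}^n\int_0^t\frac{(\lambda s)^j}{j!}e^{-\lambda s}f^{j*}(u+c_1s)\,w_\infty(0,n+1-j,t-s)\,ds,$$ where, for every $n\ge1$, $$w_\infty(0,n,t)=\frac{\lambda}{c_1}\int_0^{c_1t}\bar F(x)\,g_1(x,n-1,t)\,dx.$$ -/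

import Mathlib

open MeasureTheory ProbabilityTheory Set
open scoped ENNReal

noncomputable section

namespace ClassicalRisk

/-- `f` is a probability density function of a non-negative random variable. -/
structure IsClaimDensity (f : ℝ → ℝ) : Prop where
  measurable : Measurable f
  nonneg : ∀ x, 0 ≤ f x
  eq_zero_of_neg : ∀ x, x < 0 → f x = 0
  lintegral_eq_one : ∫⁻ x, ENNReal.ofReal (f x) = 1

/-- The tail `F̄ x = 1 - F x` of the distribution with density `f`. -/
def tail (f : ℝ → ℝ) (x : ℝ) : ℝ := ∫ y in Ioi x, f y

/-- The convolution `(g * h)(t) = ∫_0^t g(x) h(t - x) dx` of functions on the half-line. -/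
def conv (g h : ℝ → ℝ) (t : ℝ) : ℝ := ∫ x in (0 : ℝ)..t, g x * h (t - x)

/-- The `n`-fold convolution `f^{n*}` of `f` with itself, for `n ≥ 1`. (The convolution power of
order `0` is a unit point mass at `0`, not a function; the value given here at `0` is never used.) -/
def convPow (f : ℝ → ℝ) : ℕ → ℝ → ℝ
  | 0 => fun _ => 0
  | 1 => f
  | n + 2 => conv (convPow f (n + 1)) f

/-- For fixed `t`, the measure `g(x, n, t) dx` in the variable `x`, where
`g(x, 0, t) = δ_{x/c}(t) e^{-lam x / c}` and, for `n ≥ 1`,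
`g(x, n, t) = x t^{n-1} e^{-lam t} lam^n f^{n*}(c t - x) / n!`.
As `δ` is the impulse function normalised by `∫ δ_{x/c}(t) dt = 1`, i.e. `δ_{x/c}(t) = δ(t - x/c)`,
the measure `δ_{x/c}(t) dx` is `c` times the unit point mass at `x = c t`. -/
def gMeasure (c lam : ℝ) (f : ℝ → ℝ) : ℕ → ℝ → Measure ℝ
  | 0, t => (ENNReal.ofReal c • Measure.dirac (c * t)).withDensity
      fun x => ENNReal.ofReal (Real.exp (-(lam * x / c)))
  | n + 1, t => (volume.restrict (Ioo 0 (c * t))).withDensity fun x => ENNReal.ofReal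
      (x * t ^ n * Real.exp (-(lam * t)) * lam ^ (n + 1) * convPow f (n + 1) (c * t - x)
        / (n + 1).factorial)

variable {Ω : Type*}

/-- The probabilistic data of the classical risk process: i.i.d. claims `X 0, X 1, …` with density
`f`, and, independent of them, a Poisson process of rate `lam`, given by its i.i.d. exponentially
distributed inter-arrival times `W 0, W 1, …`. -/
structure IsModel [MeasurableSpace Ω] (P : Measure Ω) (lam : ℝ) (f : ℝ → ℝ)
    (W X : ℕ → Ω → ℝ) : Prop where
  measurable_interarrival : ∀ i, Measurable (W i)
  measurable_claim : ∀ i, Measurable (X i)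
  law_interarrival : ∀ i, P.map (W i) = expMeasure lam
  law_claim : ∀ i, P.map (X i) = volume.withDensity fun x => ENNReal.ofReal (f x)
  indep : iIndepFun (fun i : ℕ ⊕ ℕ => Sum.elim W X i) P

/-- The time of the `k`-th claim, `k ≥ 1`. -/
def arrival (W : ℕ → Ω → ℝ) (k : ℕ) (ω : Ω) : ℝ := ∑ i ∈ Finset.range k, W i ω

/-- The number `N_t` of claims in `[0, t]`. -/
def count (W : ℕ → Ω → ℝ) (t : ℝ) (ω : Ω) : ℕ := {k : ℕ | 1 ≤ k ∧ arrival W k ω ≤ t}.ncard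

/-- The surplus `U(t) = u + c t - ∑_{i ≤ N_t} X_i`. -/
def surplus (c : ℝ) (W X : ℕ → Ω → ℝ) (u t : ℝ) (ω : Ω) : ℝ :=
  u + c * t - ∑ i ∈ Finset.range (count W t ω), X i ω

/-- The ruin time `τ = inf {t > 0 : U(t) < 0}`, equal to `∞` if there is no such `t`. -/
def ruinTime (c : ℝ) (W X : ℕ → Ω → ℝ) (u : ℝ) (ω : Ω) : ℝ≥0∞ :=
  ⨅ t ∈ {t : ℝ | 0 < t ∧ surplus c W X u t ω < 0}, ENNReal.ofReal t

/-- The event `{τ < ∞, N_τ = n, τ ∈ A}` for the initial capital `u`. -/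
def ruinEvent (c : ℝ) (W X : ℕ → Ω → ℝ) (u : ℝ) (n : ℕ) (A : Set ℝ) : Set Ω :=
  {ω | ruinTime c W X u ω < ∞ ∧ count W (ruinTime c W X u ω).toReal ω = n ∧
    (ruinTime c W X u ω).toReal ∈ A}

/-- `w u n t` is a joint density `P(N_τ = n, τ ∈ dt | U(0) = u) / dt` (`u ≥ 0`, `n ≥ 1`, `t > 0`) of
the ruin time and the number of claims until ruin. -/
structure IsJointDensity [MeasurableSpace Ω] (P : Measure Ω) (c : ℝ) (W X : ℕ → Ω → ℝ)
    (w : ℝ → ℕ → ℝ → ℝ) : Prop where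
  measurable : ∀ u, 0 ≤ u → ∀ n, 1 ≤ n → Measurable (w u n)
  nonneg : ∀ u, 0 ≤ u → ∀ n, 1 ≤ n → ∀ t, 0 ≤ w u n t
  prob_eq : ∀ u, 0 ≤ u → ∀ n, 1 ≤ n → ∀ A : Set ℝ, MeasurableSet A →
    P (ruinEvent c W X u n A) = ∫⁻ t in A ∩ Ioi 0, ENNReal.ofReal (w u n t)

end ClassicalRisk

end

/-! Between claims the surplus rises, so ruin can only happen at a claim. With T_k the arrival times
and S_k the claim totals, ruin with claim n + 1 is almost surely the event that S_k ≤ u + c T_k for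
k ≤ n while S_{n+1} > u + c T_{n+1}. Integrating out the last claim turns P(N_τ = n + 1, τ ∈ A) into
`preRuin`, the expectation of h(T_{n+1}, S_n) on survival of n claims, for h(t, v) = 1_A(t) F̄(u + c
t - v). Independence gives a one-step recursion, `IsModel.preRuin_succ`, along which two formulas
are proved by induction.

For u = 0 this is a ballot theorem, `IsModel.preRuin_ballot`: survival multiplies the joint law of
T_{n+1} and S_n by the positive part of 1 - v / (c t). Adding a claim preserves this shape by
exchangeability, adding a waiting time by an explicit primitive. The substitution x = c t - v then
gives w(0, n, t).

For u ≥ 0, `IsModel.preRuin_add_lastRecovery` replaces survival by the weaker demand that the level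
be non-negative just before claim n + 1; the resulting law is explicit. Such a path either was never
ruined, or there is a last time s at which it climbs back to level 0, with some j ≥ 1 claims
totalling u + c s. From s on it behaves as a process without initial capital that survives n - j
claims. Subtracting these paths gives the recursion; the factor c₁ is the Jacobian of v = u + c s.

All terms of this decomposition are non-negative and its left side has a finite density. This yields
absolute continuity, hence existence of w by Radon–Nikodym, and also the absolute convergence of all
the integrals. -/

namespace ClassicalRisk

/-! ### Ruin happens at claim times -/

section Paths

variable {Ω : Type*} {c : ℝ} {W X : ℕ → Ω → ℝ} {u : ℝ} {ω : Ω}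

/-- The total of the first `k` claims. -/
def claimTotal (X : ℕ → Ω → ℝ) (k : ℕ) (ω : Ω) : ℝ := ∑ i ∈ Finset.range k, X i ω

/-- The event that none of the claims up to the `n`-th one causes ruin. -/
def noRuin (c : ℝ) (W X : ℕ → Ω → ℝ) (u : ℝ) (n : ℕ) : Set Ω :=
  {ω | ∀ k ≤ n, claimTotal X k ω ≤ u + c * arrival W k ω}

@[simp] lemma arrival_zero : arrival W 0 ω = 0 := by simp [arrival]

@[simp] lemma claimTotal_zero : claimTotal X 0 ω = 0 := by simp [claimTotal]

lemma arrival_succ (k : ℕ) : arrival W (k + 1) ω = arrival W k ω + W k ω :=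
  Finset.sum_range_succ _ _

lemma claimTotal_succ (k : ℕ) : claimTotal X (k + 1) ω = claimTotal X k ω + X k ω :=
  Finset.sum_range_succ _ _

lemma arrival_strictMono (hW : ∀ i, 0 < W i ω) : StrictMono fun k => arrival W k ω :=
  strictMono_nat_of_lt_succ fun k => by simpa [arrival_succ] using hW k

/-- Finiteness of the set of arrivals up to t is not needed: an infinite set has `ncard` 0, and the
claim then reads 0 ≤ t. If arrival number `count` came after t, monotonicity would leave at most
`count - 1` arrivals up to t. -/
lemma arrival_count_le (hW : ∀ i, 0 < W i ω) {t : ℝ} (ht : 0 ≤ t) :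
    arrival W (count W t ω) ω ≤ t := by
  by_contra! h
  have hm := (arrival_strictMono hW).monotone
  have hne : count W t ω ≠ 0 := by
    intro h0
    rw [h0, arrival_zero] at h
    linarith
  have hsub : {k : ℕ | 1 ≤ k ∧ arrival W k ω ≤ t} ⊆ Finset.Icc 1 (count W t ω - 1) := by
    rintro k ⟨h1, hk⟩
    have : k < count W t ω := by
      by_contra! h'
      exact absurd (h.trans_le (hm h')) (not_lt.2 hk)
    simp only [Finset.coe_Icc, mem_Icc]
    omega
  have := Set.ncard_le_ncard hsub (Finset.finite_toSet _)
  rw [Set.ncard_coe_finset, Nat.card_Icc] at this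
  change count W t ω ≤ _ at this
  omega

lemma count_arrival (hW : ∀ i, 0 < W i ω) (n : ℕ) : count W (arrival W n ω) ω = n := by
  have : {k : ℕ | 1 ≤ k ∧ arrival W k ω ≤ arrival W n ω} = Finset.Icc 1 n := by
    ext k
    simp [(arrival_strictMono hW).le_iff_le (a := k) (b := n)]
  rw [count, this, Set.ncard_coe_finset, Nat.card_Icc]
  omega

/-- Premiums only increase the surplus between claims, so a surplus negative at t was already
negative at the last claim before t. -/
lemma exists_of_surplus_neg (hc : 0 < c) (hW : ∀ i, 0 < W i ω) {t : ℝ} (ht : 0 ≤ t)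
    (h : surplus c W X u t ω < 0) :
    ∃ m, arrival W m ω ≤ t ∧ u + c * arrival W m ω < claimTotal X m ω := by
  refine ⟨count W t ω, arrival_count_le hW ht, ?_⟩
  have := mul_le_mul_of_nonneg_left (arrival_count_le hW ht) hc.le
  simp only [surplus] at h
  simp only [claimTotal]
  linarith

lemma ruinTime_eq_arrival (hc : 0 < c) (hW : ∀ i, 0 < W i ω) {n : ℕ}
    (hn : ω ∈ noRuin c W X u n)
    (h : u + c * arrival W (n + 1) ω < claimTotal X (n + 1) ω) :
    ruinTime c W X u ω = ENNReal.ofReal (arrival W (n + 1) ω) := by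
  have hm := arrival_strictMono hW
  apply le_antisymm
  · refine iInf₂_le _ ⟨?_, ?_⟩
    · simpa using hm (Nat.succ_pos n)
    · rw [surplus, count_arrival hW]
      simp only [claimTotal] at h
      linarith
  · refine le_iInf₂ fun t ht => ENNReal.ofReal_le_ofReal ?_
    obtain ⟨m, hmt, hmb⟩ := exists_of_surplus_neg hc hW ht.1.le ht.2
    refine le_trans (hm.monotone ?_) hmt
    by_contra! hlt
    exact absurd (hn m (by omega)) (not_le.2 hmb)

lemma ruinTime_eq_top (hc : 0 < c) (hW : ∀ i, 0 < W i ω)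
    (h : ∀ k, claimTotal X k ω ≤ u + c * arrival W k ω) :
    ruinTime c W X u ω = ∞ := by
  simp only [ruinTime, iInf_eq_top]
  intro t ht
  obtain ⟨m, -, hmb⟩ := exists_of_surplus_neg hc hW ht.1.le ht.2
  exact absurd (h m) (not_le.2 hmb)

/-- Replaces the infimum in `ruinTime` by finitely many inequalities: N_τ is the least index at
which the claims exceed capital and premiums, and u ≥ 0 excludes index 0. -/
lemma mem_ruinEvent_iff (hc : 0 < c) (hu : 0 ≤ u) (hW : ∀ i, 0 < W i ω) (n : ℕ) (A : Set ℝ) :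
    ω ∈ ruinEvent c W X u (n + 1) A ↔ ω ∈ noRuin c W X u n ∧ arrival W (n + 1) ω ∈ A ∧
      u + c * arrival W (n + 1) ω < claimTotal X (n + 1) ω := by
  have key : ∀ m, ω ∈ noRuin c W X u m →
      u + c * arrival W (m + 1) ω < claimTotal X (m + 1) ω →
      (ruinTime c W X u ω).toReal = arrival W (m + 1) ω ∧ ruinTime c W X u ω < ∞ := by
    intro m h1 h2
    have h0 := arrival_strictMono hW (Nat.succ_pos m)
    simp only [arrival_zero, Nat.succ_eq_add_one] at h0
    rw [ruinTime_eq_arrival hc hW h1 h2, ENNReal.toReal_ofReal h0.le]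
    simp
  constructor
  · rintro ⟨h1, h2, h3⟩
    by_cases hex : ∃ k, u + c * arrival W k ω < claimTotal X k ω
    · classical
      have hk := Nat.find_spec hex
      have hmin := fun m => Nat.find_min hex (m := m)
      rcases hk0 : Nat.find hex with _ | m
      · rw [hk0] at hk
        simp only [arrival_zero, claimTotal_zero] at hk
        linarith
      · rw [hk0] at hk hmin
        have hno : ω ∈ noRuin c W X u m := fun k hkm => not_lt.1 (hmin k (by omega))
        obtain ⟨h4, h5⟩ := key m hno hk
        rw [h4, count_arrival hW] at h2
        obtain rfl : m = n := by omega
        exact ⟨hno, h4 ▸ h3, hk⟩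
    · push Not at hex
      rw [ruinTime_eq_top hc hW hex] at h1
      exact absurd h1 (lt_irrefl _)
  · rintro ⟨h1, h2, h3⟩
    obtain ⟨h4, h5⟩ := key n h1 h3
    refine ⟨h5, ?_, ?_⟩
    · rw [h4, count_arrival hW]
    · rwa [h4]

end Paths

/-! ### Exponential waiting times -/

section Time

variable {lam : ℝ}

lemma lintegral_expMeasure (lam : ℝ) {H : ℝ → ℝ≥0∞} (hH : Measurable H) :
    ∫⁻ s, H s ∂(expMeasure lam) =
      ∫⁻ s in Ioi 0, ENNReal.ofReal (lam * Real.exp (-(lam * s))) * H s := by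
  have hm : Measurable (gammaPDF 1 lam) := (measurable_gammaPDFReal 1 lam).ennreal_ofReal
  rw [expMeasure, gammaMeasure, lintegral_withDensity_eq_lintegral_mul _ hm hH,
    ← setLIntegral_univ, ← lintegral_indicator MeasurableSet.univ,
    ← lintegral_indicator measurableSet_Ioi]
  have h0 : ∀ᵐ s : ℝ, s ≠ 0 := by simp [ae_iff]
  refine lintegral_congr_ae ?_
  filter_upwards [h0] with s hs
  have := exponentialPDF_eq lam s
  rw [exponentialPDF, exponentialPDFReal] at this
  simp only [indicator_univ, Pi.mul_apply, gammaPDF, this]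
  rcases lt_or_gt_of_ne hs with h | h
  · simp [h.not_ge, h.le]
  · simp [h.le, h]

/-- The probability that a Poisson variable of parameter `lam * t` equals `j`. -/
noncomputable def poissonWeight (lam : ℝ) (j : ℕ) (t : ℝ) : ℝ :=
  (lam * t) ^ j / j.factorial * Real.exp (-(lam * t))

lemma continuous_poissonWeight (lam : ℝ) (j : ℕ) : Continuous (poissonWeight lam j) := by
  unfold poissonWeight; fun_prop

@[fun_prop]
lemma measurable_poissonWeight (lam : ℝ) (j : ℕ) : Measurable (poissonWeight lam j) :=
  (continuous_poissonWeight lam j).measurable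

lemma poissonWeight_nonneg (hlam : 0 ≤ lam) (j : ℕ) {t : ℝ} (ht : 0 ≤ t) :
    0 ≤ poissonWeight lam j t := by
  unfold poissonWeight; positivity

lemma lintegral_Ioo_eq_indicator (φ : ℝ → ℝ → ℝ≥0∞) (a r : ℝ) : ∫⁻ t in Ioo a r, φ t r =
    ∫⁻ t, {p : ℝ × ℝ | a < p.1 ∧ p.1 < p.2}.indicator (Function.uncurry φ) (t, r) := by
  rw [← lintegral_indicator measurableSet_Ioo]
  refine lintegral_congr fun t => ?_
  simp only [indicator, mem_Ioo, Function.uncurry]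
  congr

lemma lintegral_triangle_swap {φ : ℝ → ℝ → ℝ≥0∞} (hφ : Measurable (Function.uncurry φ)) (a : ℝ) :
    ∫⁻ t in Ioi a, ∫⁻ r in Ioi t, φ t r = ∫⁻ r in Ioi a, ∫⁻ t in Ioo a r, φ t r := by
  have h1 : ∀ t, (Ioi a).indicator (fun t => ∫⁻ r in Ioi t, φ t r) t =
      ∫⁻ r, {p : ℝ × ℝ | a < p.1 ∧ p.1 < p.2}.indicator (Function.uncurry φ) (t, r) := by
    intro t
    by_cases ht : a < t
    · simp only [indicator, mem_Ioi, ht, if_true, mem_ofPred_eq, true_and]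
      rw [← lintegral_indicator measurableSet_Ioi]
      simp [indicator, Function.uncurry]
    · simp [indicator, ht]
  have h2 : ∀ r, (Ioi a).indicator (fun r => ∫⁻ t in Ioo a r, φ t r) r =
      ∫⁻ t, {p : ℝ × ℝ | a < p.1 ∧ p.1 < p.2}.indicator (Function.uncurry φ) (t, r) := by
    intro r
    rw [← lintegral_Ioo_eq_indicator]
    by_cases hr : a < r
    · simp [indicator, hr]
    · simp [indicator, hr]
  have hs : MeasurableSet {p : ℝ × ℝ | a < p.1 ∧ p.1 < p.2} :=
    (measurableSet_lt measurable_const measurable_fst).inter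
      (measurableSet_lt measurable_fst measurable_snd)
  rw [← lintegral_indicator measurableSet_Ioi, ← lintegral_indicator measurableSet_Ioi]
  simp_rw [h1, h2]
  exact lintegral_lintegral_swap (hφ.indicator hs).aemeasurable

lemma lintegral_Ioo_ofReal_deriv {g G : ℝ → ℝ} {a r : ℝ} (har : a ≤ r) (hg : Continuous g)
    (hG : ∀ t, HasDerivAt G (g t) t) (hpos : ∀ t, a < t → 0 ≤ g t) :
    ∫⁻ t in Ioo a r, ENNReal.ofReal (g t) = ENNReal.ofReal (G r - G a) := by
  rw [← intervalIntegral.integral_eq_sub_of_hasDerivAt (fun t _ => hG t)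
    (hg.intervalIntegrable a r), intervalIntegral.integral_of_le har,
    setLIntegral_congr Ioo_ae_eq_Ioc]
  rw [ofReal_integral_eq_lintegral_ofReal]
  · exact (hg.intervalIntegrable a r).1
  · exact (ae_restrict_iff' measurableSet_Ioc).2 (.of_forall fun t ht => hpos t ht.1)

lemma lintegral_shift_Ioi (t : ℝ) (φ : ℝ → ℝ≥0∞) :
    ∫⁻ s in Ioi 0, φ (t + s) = ∫⁻ r in Ioi t, φ r := by
  rw [← lintegral_indicator measurableSet_Ioi, ← lintegral_indicator measurableSet_Ioi,
    ← lintegral_add_left_eq_self ((Ioi t).indicator φ) t]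
  simp [indicator]

/-- Adding an exponential waiting time to a time with density `g t * exp (-(lam * t))`. -/
lemma lintegral_add_waiting (hlam : 0 ≤ lam) {g G : ℝ → ℝ} {a : ℝ} (hg : Continuous g)
    (hG : ∀ t, HasDerivAt G (g t) t) (hpos : ∀ t, a < t → 0 ≤ g t)
    {H : ℝ → ℝ≥0∞} (hH : Measurable H) :
    ∫⁻ t in Ioi a, ENNReal.ofReal (g t * Real.exp (-(lam * t))) *
        ∫⁻ s, H (t + s) ∂(expMeasure lam) =
      ∫⁻ t in Ioi a, ENNReal.ofReal (lam * (G t - G a) * Real.exp (-(lam * t))) * H t := by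
  -- With r = t + s the two exponentials combine to exp (-(lam * r)), so after exchanging the
  -- integrals only `g` remains to be integrated over (a, r).
  have h1 : ∀ t ∈ Ioi a, ENNReal.ofReal (g t * Real.exp (-(lam * t))) *
        ∫⁻ s, H (t + s) ∂(expMeasure lam) =
      ∫⁻ r in Ioi t, ENNReal.ofReal (g t) *
        (ENNReal.ofReal (lam * Real.exp (-(lam * r))) * H r) := by
    intro t ht
    rw [lintegral_expMeasure lam (by fun_prop), ← lintegral_shift_Ioi t,
      ← lintegral_const_mul _ (by fun_prop)]
    refine lintegral_congr fun s => ?_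
    rw [← mul_assoc, ← mul_assoc, ← ENNReal.ofReal_mul' (by positivity),
      ← ENNReal.ofReal_mul' (by positivity)]
    congr 2
    rw [mul_add, neg_add, Real.exp_add]
    ring
  rw [setLIntegral_congr_fun measurableSet_Ioi h1, lintegral_triangle_swap (by
    have := hg.measurable
    unfold Function.uncurry; fun_prop)]
  refine setLIntegral_congr_fun measurableSet_Ioi fun r (hr : a < r) => ?_
  have := hg.measurable
  rw [lintegral_mul_const _ (by fun_prop), lintegral_Ioo_ofReal_deriv hr.le hg hG hpos,
    ← mul_assoc, ← ENNReal.ofReal_mul' (by positivity)]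
  congr 2
  ring

lemma hasDerivAt_poissonPower (lam : ℝ) (n : ℕ) (t : ℝ) :
    HasDerivAt (fun t => (lam * t) ^ (n + 1) / (n + 1).factorial)
      (lam * ((lam * t) ^ n / n.factorial)) t := by
  have h := (((hasDerivAt_id t).const_mul lam).pow (n + 1)).div_const ((n + 1).factorial : ℝ)
  convert! h using 1
  have : (n.factorial : ℝ) ≠ 0 := by positivity
  have : (n + 1 : ℝ) ≠ 0 := by positivity
  simp only [id, Nat.factorial_succ, Nat.add_sub_cancel]
  push_cast
  field_simp

/-- The decomposition, according to whether `τ` lies before or after the previous arrival time, of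
the event that the next arrival time is after `τ`. -/
lemma lintegral_arrival_split (hlam : 0 ≤ lam) (n : ℕ) (τ : ℝ) {H : ℝ → ℝ≥0∞}
    (hH : Measurable H) :
    ∫⁻ t in Ioi 0, ENNReal.ofReal (lam * poissonWeight lam (n + 1) t) *
        (if τ ≤ t then H t else 0) =
      (∫⁻ t in Ioi 0, ENNReal.ofReal (lam * poissonWeight lam n t) *
        (if τ ≤ t then ∫⁻ s, H (t + s) ∂(expMeasure lam) else 0)) +
      (if 0 < τ then ENNReal.ofReal (poissonWeight lam (n + 1) τ) else 0) *
        ∫⁻ s, H (s + τ) ∂(expMeasure lam) := by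
  -- Integration from `max 0 τ` treats both signs of τ at once; the endpoint t = τ is a null set.
  have hred : ∀ φ : ℝ → ℝ≥0∞, ∀ k, ∫⁻ t in Ioi 0, ENNReal.ofReal (lam * poissonWeight lam k t) *
        (if τ ≤ t then φ t else 0) =
      ∫⁻ t in Ioi (max 0 τ), ENNReal.ofReal (lam * poissonWeight lam k t) * φ t := by
    intro φ k
    rw [← lintegral_indicator measurableSet_Ioi, ← lintegral_indicator measurableSet_Ioi]
    have h0 : ∀ᵐ s : ℝ, s ≠ τ := by simp [ae_iff]
    refine lintegral_congr_ae ?_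
    filter_upwards [h0] with t ht
    rcases lt_or_gt_of_ne ht with h | h
    · simp [indicator, h.not_ge, h.not_gt]
    · simp [indicator, h.le, h]
  rw [hred, hred]
  have hstep := lintegral_add_waiting (lam := lam) hlam (a := max 0 τ)
    (g := fun t => lam * ((lam * t) ^ n / n.factorial))
    (G := fun t => (lam * t) ^ (n + 1) / (n + 1).factorial) (by fun_prop)
    (hasDerivAt_poissonPower lam n)
    (fun t ht => by
      have : 0 ≤ t := (le_max_left _ _).trans ht.le
      positivity) hH
  have e1 : ∀ t, lam * ((lam * t) ^ n / n.factorial) * Real.exp (-(lam * t)) =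
      lam * poissonWeight lam n t := fun t => by simp only [poissonWeight]; ring
  simp only [e1] at hstep
  rw [hstep]
  -- This term restores the constant of integration `G (max 0 τ)` subtracted in `hstep`. For τ ≤ 0
  -- that constant is 0, since the power is n + 1.
  have hlast : (if 0 < τ then ENNReal.ofReal (poissonWeight lam (n + 1) τ) else 0) *
        ∫⁻ s, H (s + τ) ∂(expMeasure lam) =
      ∫⁻ t in Ioi (max 0 τ), ENNReal.ofReal
        (lam * ((lam * max 0 τ) ^ (n + 1) / (n + 1).factorial) * Real.exp (-(lam * t))) * H t := by
    split_ifs with hτ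
    · rw [max_eq_right hτ.le, lintegral_expMeasure lam (by fun_prop), ← lintegral_shift_Ioi τ,
        ← lintegral_const_mul _ (by fun_prop)]
      refine lintegral_congr fun s => ?_
      rw [← mul_assoc, ← ENNReal.ofReal_mul (poissonWeight_nonneg hlam _ hτ.le), add_comm s τ]
      congr 2
      simp only [poissonWeight]
      rw [mul_add, neg_add, Real.exp_add]
      ring
    · rw [max_eq_left (not_lt.1 hτ)]
      simp
  rw [hlast, ← lintegral_add_left (by fun_prop)]
  refine setLIntegral_congr_fun measurableSet_Ioi fun t (ht : max 0 τ < t) => ?_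
  have h0 : 0 ≤ max 0 τ := le_max_left _ _
  have h1 : (lam * max 0 τ) ^ (n + 1) ≤ (lam * t) ^ (n + 1) := by gcongr
  rw [← add_mul, ← ENNReal.ofReal_add]
  · congr 2
    simp only [poissonWeight]
    ring
  · have : 0 ≤ (lam * t) ^ (n + 1) / ((n + 1).factorial : ℝ) -
        (lam * max 0 τ) ^ (n + 1) / ((n + 1).factorial : ℝ) := by
      rw [← sub_div]
      exact div_nonneg (sub_nonneg.2 h1) (by positivity)
    positivity
  · positivity

end Time

/-! ### Sums of claims -/

section Claims

variable {f : ℝ → ℝ}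

/-- The law of a claim with density `f`. -/
noncomputable def claimLaw (f : ℝ → ℝ) : Measure ℝ := volume.withDensity fun x => ENNReal.ofReal (f x)

instance : SFinite (claimLaw f) := by unfold claimLaw; infer_instance

/-- The law of the sum of `n` independent claims with density `f`. -/
noncomputable def claimSum (f : ℝ → ℝ) : ℕ → Measure ℝ
  | 0 => Measure.dirac 0
  | n + 1 => (claimSum f n).conv (claimLaw f)

instance (n : ℕ) : SFinite (claimSum f n) := by
  induction n with
  | zero => unfold claimSum; infer_instance
  | succ n ih => unfold claimSum; infer_instance

lemma lintegral_claimSum_succ (n : ℕ) {φ : ℝ → ℝ≥0∞} (hφ : Measurable φ) :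
    ∫⁻ v, φ v ∂(claimSum f (n + 1)) = ∫⁻ v, ∫⁻ x, φ (v + x) ∂(claimLaw f) ∂(claimSum f n) := by
  rw [claimSum, Measure.lintegral_conv hφ]

lemma IsClaimDensity.isProbabilityMeasure (hf : IsClaimDensity f) :
    IsProbabilityMeasure (claimLaw f) :=
  ⟨by rw [claimLaw, withDensity_apply _ MeasurableSet.univ, setLIntegral_univ,
    hf.lintegral_eq_one]⟩

lemma IsClaimDensity.ae_nonneg (hf : IsClaimDensity f) : ∀ᵐ x ∂(claimLaw f), 0 ≤ x := by
  rw [claimLaw, ae_withDensity_iff hf.measurable.ennreal_ofReal]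
  refine .of_forall fun x hx => ?_
  by_contra! h
  simp [hf.eq_zero_of_neg x h] at hx

lemma isProbabilityMeasure_claimSum (hf : IsClaimDensity f) (n : ℕ) :
    IsProbabilityMeasure (claimSum f n) := by
  have := hf.isProbabilityMeasure
  induction n with
  | zero => unfold claimSum; infer_instance
  | succ n ih => unfold claimSum; infer_instance

lemma ae_claimSum_nonneg (hf : IsClaimDensity f) (n : ℕ) : ∀ᵐ x ∂(claimSum f n), 0 ≤ x := by
  induction n with
  | zero => rw [claimSum, ae_dirac_iff measurableSet_Ici]
  | succ n ih =>
    have hm : MeasurableSet {x : ℝ | x < 0} := measurableSet_Iio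
    rw [ae_iff]
    simp only [not_le]
    rw [← lintegral_indicator_one hm, lintegral_claimSum_succ n (by measurability),
      lintegral_eq_zero_iff (by fun_prop (disch := exact hm))]
    filter_upwards [ih] with v hv
    simp only [Pi.zero_apply]
    rw [lintegral_eq_zero_iff (by fun_prop (disch := exact hm))]
    filter_upwards [hf.ae_nonneg] with x hx
    simp [indicator, not_lt.2 (add_nonneg hv hx)]

/-- By exchangeability the conditional expectation of a claim, given the sum of `n + 1` claims, is
the fraction `1 / (n + 1)` of the sum. -/
lemma lintegral_claimSum_exchange (hf : IsClaimDensity f) (n : ℕ) {ψ : ℝ → ℝ≥0∞}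
    (hψ : Measurable ψ) :
    ((n + 1 : ℕ) : ℝ≥0∞) * ∫⁻ v, ∫⁻ x, ENNReal.ofReal x * ψ (v + x) ∂(claimLaw f) ∂(claimSum f n) =
      ∫⁻ v, ENNReal.ofReal v * ψ v ∂(claimSum f (n + 1)) := by
  induction n generalizing ψ with
  | zero =>
    rw [lintegral_claimSum_succ 0 (by fun_prop), claimSum,
      lintegral_dirac' _ (by fun_prop), lintegral_dirac' _ (by fun_prop)]
    simp
  | succ n ih =>
    have h1 : ∫⁻ v, ENNReal.ofReal v * ψ v ∂(claimSum f (n + 1 + 1)) =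
        (∫⁻ v, ∫⁻ x, ENNReal.ofReal v * ψ (v + x) ∂(claimLaw f) ∂(claimSum f (n + 1))) +
        ∫⁻ v, ∫⁻ x, ENNReal.ofReal x * ψ (v + x) ∂(claimLaw f) ∂(claimSum f (n + 1)) := by
      rw [lintegral_claimSum_succ (n + 1) (by fun_prop), ← lintegral_add_left (by fun_prop)]
      refine lintegral_congr_ae ?_
      filter_upwards [ae_claimSum_nonneg hf (n + 1)] with v hv
      rw [← lintegral_add_left (by fun_prop)]
      refine lintegral_congr_ae ?_
      filter_upwards [hf.ae_nonneg] with x hx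
      rw [ENNReal.ofReal_add hv hx, add_mul]
    -- With the last claim frozen at y, the induction hypothesis applies to the test function v ↦
    -- ψ(v + y). The last two claims have the same law, so renaming them identifies the two sides.
    have h2 : ∫⁻ v, ∫⁻ x, ENNReal.ofReal v * ψ (v + x) ∂(claimLaw f) ∂(claimSum f (n + 1)) =
        ((n + 1 : ℕ) : ℝ≥0∞) *
          ∫⁻ v, ∫⁻ x, ENNReal.ofReal x * ψ (v + x) ∂(claimLaw f) ∂(claimSum f (n + 1)) := by
      rw [lintegral_lintegral_swap (by unfold Function.uncurry; fun_prop)]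
      have : ∀ y, ∫⁻ v, ENNReal.ofReal v * ψ (v + y) ∂(claimSum f (n + 1)) =
          ((n + 1 : ℕ) : ℝ≥0∞) * ∫⁻ v, ∫⁻ x, ENNReal.ofReal x * ψ (v + x + y) ∂(claimLaw f)
            ∂(claimSum f n) := fun y => (ih (ψ := fun v => ψ (v + y)) (by fun_prop)).symm
      simp_rw [this]
      rw [lintegral_const_mul _ (by fun_prop), lintegral_claimSum_succ n (by fun_prop),
        lintegral_lintegral_swap (by unfold Function.uncurry; fun_prop)]
      congr 1
      refine lintegral_congr fun v => ?_
      refine lintegral_congr fun x => ?_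
      refine lintegral_congr fun y => ?_
      rw [add_right_comm]
    rw [h1, h2, Nat.cast_succ (n + 1), add_mul, one_mul]

end Claims

/-! ### The risk process without ruin as a Markov chain -/

instance (lam : ℝ) : SFinite (expMeasure lam) := by
  unfold expMeasure gammaMeasure; infer_instance

section Independence

variable {Ω : Type*} {W X : ℕ → Ω → ℝ}

/-- The σ-algebra generated by the first `i` inter-arrival times and the first `j` claims. -/
@[reducible] def past (W X : ℕ → Ω → ℝ) (i j : ℕ) : MeasurableSpace Ω :=
  ⨆ k ∈ {k : ℕ ⊕ ℕ | Sum.elim (· < i) (· < j) k},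
    MeasurableSpace.comap (Sum.elim W X k) inferInstance

lemma measurable_past_interarrival {i j k : ℕ} (hk : k < i) : Measurable[past W X i j] (W k) :=
  Measurable.of_comap_le (le_iSup₂_of_le (Sum.inl k) hk le_rfl)

lemma measurable_past_claim {i j k : ℕ} (hk : k < j) : Measurable[past W X i j] (X k) :=
  Measurable.of_comap_le (le_iSup₂_of_le (Sum.inr k) hk le_rfl)

lemma measurable_past_arrival {i j k : ℕ} (hk : k ≤ i) :
    Measurable[past W X i j] (arrival W k) := by
  refine Finset.measurable_sum _ fun l hl => measurable_past_interarrival ?_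
  exact (Finset.mem_range.1 hl).trans_le hk

lemma measurable_past_claimTotal {i j k : ℕ} (hk : k ≤ j) :
    Measurable[past W X i j] (claimTotal X k) := by
  refine Finset.measurable_sum _ fun l hl => measurable_past_claim ?_
  exact (Finset.mem_range.1 hl).trans_le hk

lemma measurableSet_past_noRuin (c u : ℝ) {i j n : ℕ} (hi : n ≤ i) (hj : n ≤ j) :
    MeasurableSet[past W X i j] (noRuin c W X u n) := by
  have : noRuin c W X u n = ⋂ k, ⋂ (_ : k ≤ n),
      {ω | claimTotal X k ω ≤ u + c * arrival W k ω} := by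
    ext ω; simp [noRuin]
  rw [this]
  refine MeasurableSet.iInter fun k => MeasurableSet.iInter fun hk => ?_
  exact measurableSet_le (measurable_past_claimTotal (hk.trans hj))
    (((measurable_past_arrival (hk.trans hi)).const_mul c).const_add u)

/-- The survival indicator is made a coordinate of the state so that `IsModel.lintegral_past`
applies directly. Waiting times and claims are counted separately because just before claim n + 1
there are n + 1 known waiting times but only n known claims. -/
lemma measurable_past_state (c u : ℝ) {a b i j n : ℕ} (ha : a ≤ i) (hb : b ≤ j) (hi : n ≤ i)
    (hj : n ≤ j) : Measurable[past W X i j] fun ω =>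
      ((arrival W a ω, claimTotal X b ω), (noRuin c W X u n).indicator (1 : Ω → ℝ≥0∞) ω) :=
  letI := past W X i j
  ((measurable_past_arrival ha).prodMk (measurable_past_claimTotal hb)).prodMk
    (measurable_one.indicator (measurableSet_past_noRuin c u hi hj))

variable [MeasurableSpace Ω] {P : Measure Ω} {lam : ℝ} {f : ℝ → ℝ}

lemma IsModel.measurable_coord (hM : IsModel P lam f W X) (k : ℕ ⊕ ℕ) :
    Measurable (Sum.elim W X k) := by
  rcases k with k | k
  exacts [hM.measurable_interarrival k, hM.measurable_claim k]

lemma IsModel.past_le (hM : IsModel P lam f W X) (i j : ℕ) :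
    past W X i j ≤ (inferInstance : MeasurableSpace Ω) :=
  iSup₂_le fun k _ => (hM.measurable_coord k).comap_le

/-- Integrating out a coordinate which is independent of the past. -/
lemma IsModel.lintegral_past [IsProbabilityMeasure P] (hM : IsModel P lam f W X) {i j : ℕ}
    {β : Type*} [MeasurableSpace β] {Y : Ω → β} (hY : Measurable[past W X i j] Y) {k : ℕ ⊕ ℕ}
    (hk : ¬ Sum.elim (· < i) (· < j) k) {φ : β × ℝ → ℝ≥0∞} (hφ : Measurable φ) :
    ∫⁻ ω, φ (Y ω, Sum.elim W X k ω) ∂P =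
      ∫⁻ ω, ∫⁻ x, φ (Y ω, x) ∂(P.map (Sum.elim W X k)) ∂P := by
  have hY' : Measurable Y := hY.mono (hM.past_le i j) le_rfl
  have hk' := hM.measurable_coord k
  have hind : IndepFun Y (Sum.elim W X k) P := by
    rw [IndepFun_iff_Indep]
    have h1 := indep_iSup_of_disjoint (fun l => (hM.measurable_coord l).comap_le)
      ((iIndepFun_iff_iIndep _ _ _).1 hM.indep)
      (S := {k : ℕ ⊕ ℕ | Sum.elim (· < i) (· < j) k}) (T := {k}) (by simpa using hk)
    refine indep_of_indep_of_le_left (indep_of_indep_of_le_right h1 ?_) hY.comap_le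
    exact le_iSup₂_of_le k rfl le_rfl
  have := Measure.isFiniteMeasure_map P (Sum.elim W X k)
  rw [← lintegral_map (g := fun ω => (Y ω, Sum.elim W X k ω)) hφ (hY'.prodMk hk'),
    (indepFun_iff_map_prod_eq_prod_map_map hY'.aemeasurable hk'.aemeasurable).1 hind,
    lintegral_prod _ hφ.aemeasurable, lintegral_map (by fun_prop) hY']

lemma IsModel.ae_interarrival_pos (hM : IsModel P lam f W X) : ∀ᵐ ω ∂P, ∀ i, 0 < W i ω := by
  rw [ae_all_iff]
  intro i
  rw [← ae_map_iff (p := fun s => 0 < s) (hM.measurable_interarrival i).aemeasurable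
    measurableSet_Ioi, hM.law_interarrival i, ae_iff]
  simp only [not_lt]
  have hs : MeasurableSet {a : ℝ | a ≤ 0} := measurableSet_Iic
  rw [← lintegral_indicator_one hs, lintegral_expMeasure lam (by fun_prop (disch := exact hs)),
    setLIntegral_congr_fun measurableSet_Ioi (g := fun _ => 0), lintegral_zero]
  intro s (hs : 0 < s)
  simp [indicator, hs.not_ge]

end Independence

/-! ### The one-step recursion for paths not yet ruined -/

section Chain

variable {Ω : Type*} [MeasurableSpace Ω] {W X : ℕ → Ω → ℝ} {P : Measure Ω} {lam c : ℝ}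
  {f : ℝ → ℝ}

/-- The expectation of `h (T, S)` on the event that the first `n` claims do not cause ruin, where `T`
is the time of the `n + 1`-st claim and `S` the total of the first `n` claims. -/
noncomputable def preRuin (P : Measure Ω) (c : ℝ) (W X : ℕ → Ω → ℝ) (u : ℝ) (n : ℕ)
    (h : ℝ × ℝ → ℝ≥0∞) : ℝ≥0∞ :=
  ∫⁻ ω, (noRuin c W X u n).indicator 1 ω * h (arrival W (n + 1) ω, claimTotal X n ω) ∂P

/-- The transition operator of the risk process observed immediately before claims, killed at
ruin. -/
noncomputable def stepOp (c lam : ℝ) (f : ℝ → ℝ) (u : ℝ) (h : ℝ × ℝ → ℝ≥0∞) (p : ℝ × ℝ) : ℝ≥0∞ :=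
  ∫⁻ x, (if p.2 + x ≤ u + c * p.1 then ∫⁻ s, h (p.1 + s, p.2 + x) ∂(expMeasure lam) else 0)
    ∂(claimLaw f)

@[fun_prop]
lemma measurable_stepOp (u : ℝ) {h : ℝ × ℝ → ℝ≥0∞} (hh : Measurable h) :
    Measurable (stepOp c lam f u h) := by
  refine Measurable.lintegral_prod_right' (f := fun q : (ℝ × ℝ) × ℝ =>
    if q.1.2 + q.2 ≤ u + c * q.1.1 then ∫⁻ s, h (q.1.1 + s, q.1.2 + q.2) ∂(expMeasure lam)
      else 0) ?_
  exact Measurable.ite (measurableSet_le (by fun_prop) (by fun_prop)) (by fun_prop) (by fun_prop)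

lemma IsModel.measurableSet_noRuin (hM : IsModel P lam f W X) (u : ℝ) (n : ℕ) :
    MeasurableSet (noRuin c W X u n) :=
  hM.past_le n n _ (measurableSet_past_noRuin c u le_rfl le_rfl)

lemma IsModel.preRuin_zero (hM : IsModel P lam f W X) {u : ℝ} (hu : 0 ≤ u) {h : ℝ × ℝ → ℝ≥0∞}
    (hh : Measurable h) : preRuin P c W X u 0 h = ∫⁻ s, h (s, 0) ∂(expMeasure lam) := by
  rw [preRuin, ← hM.law_interarrival 0, lintegral_map (by fun_prop) (hM.measurable_interarrival 0)]
  refine lintegral_congr fun ω => ?_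
  have : ω ∈ noRuin c W X u 0 := by
    intro k hk
    obtain rfl : k = 0 := by omega
    simpa using hu
  simp [this, arrival_succ]

/-- Survival of claim n + 1 involves the claim `X n` but not the waiting time `W (n + 1)`. The
waiting time is therefore integrated out first, and then the claim. -/
lemma IsModel.preRuin_succ [IsProbabilityMeasure P] (hM : IsModel P lam f W X) (u : ℝ) (n : ℕ)
    {h : ℝ × ℝ → ℝ≥0∞} (hh : Measurable h) :
    preRuin P c W X u (n + 1) h = preRuin P c W X u n (stepOp c lam f u h) := by
  have h1 := hM.lintegral_past (measurable_past_state c u (a := n + 1) (b := n + 1) (i := n + 1)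
    (j := n + 1) (n := n + 1) le_rfl le_rfl le_rfl le_rfl) (k := Sum.inl (n + 1)) (by simp)
    (φ := fun q => q.1.2 * h (q.1.1.1 + q.2, q.1.1.2)) (by fun_prop)
  have hms : MeasurableSet {q : ((ℝ × ℝ) × ℝ≥0∞) × ℝ | q.1.1.2 + q.2 ≤ u + c * q.1.1.1} :=
    measurableSet_le (by fun_prop) (by fun_prop)
  have h2 := hM.lintegral_past (measurable_past_state c u (a := n + 1) (b := n) (i := n + 1)
    (j := n) (n := n) le_rfl le_rfl (Nat.le_succ n) le_rfl) (k := Sum.inr n) (by simp)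
    (φ := fun q => q.1.2 * if q.1.1.2 + q.2 ≤ u + c * q.1.1.1 then
      ∫⁻ s, h (q.1.1.1 + s, q.1.1.2 + q.2) ∂(expMeasure lam) else 0)
    (Measurable.mul (by fun_prop) (Measurable.ite hms (by fun_prop) (by fun_prop)))
  simp only [Sum.elim_inl, Sum.elim_inr, hM.law_interarrival, hM.law_claim] at h1 h2
  rw [preRuin, preRuin]
  calc _ = ∫⁻ ω, (noRuin c W X u (n + 1)).indicator 1 ω *
        h (arrival W (n + 1) ω + W (n + 1) ω, claimTotal X (n + 1) ω) ∂P := by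
        simp only [arrival_succ (n + 1)]
    _ = _ := h1
    _ = ∫⁻ ω, (noRuin c W X u n).indicator 1 ω *
          if claimTotal X n ω + X n ω ≤ u + c * arrival W (n + 1) ω then
            ∫⁻ s, h (arrival W (n + 1) ω + s, claimTotal X n ω + X n ω) ∂(expMeasure lam)
          else 0 ∂P := by
        refine lintegral_congr fun ω => ?_
        rw [lintegral_const_mul _ (by fun_prop)]
        have hiff : ω ∈ noRuin c W X u (n + 1) ↔ ω ∈ noRuin c W X u n ∧
            claimTotal X n ω + X n ω ≤ u + c * arrival W (n + 1) ω := by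
          constructor
          · intro hω
            refine ⟨fun k hk => hω k (by omega), ?_⟩
            rw [← claimTotal_succ]
            exact hω _ le_rfl
          · rintro ⟨hω, hlast⟩ k hk
            rcases Nat.le_succ_iff.1 hk with hk | rfl
            · exact hω k hk
            · rwa [Nat.succ_eq_add_one, claimTotal_succ]
        by_cases ha : ω ∈ noRuin c W X u n <;>
          by_cases hb : claimTotal X n ω + X n ω ≤ u + c * arrival W (n + 1) ω <;>
          simp [indicator, hiff, ha, hb, claimTotal_succ]
    _ = _ := h2
    _ = _ := by
        refine lintegral_congr fun ω => ?_
        rw [stepOp, lintegral_const_mul]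
        · rfl
        · exact Measurable.ite (measurableSet_le (by fun_prop) (by fun_prop)) (by fun_prop)
            (by fun_prop)

/-- The measurable version of the event `ruinEvent`. -/
lemma IsModel.ruinEvent_ae_eq (hM : IsModel P lam f W X) (hc : 0 < c) {u : ℝ} (hu : 0 ≤ u) (n : ℕ)
    (A : Set ℝ) : ruinEvent c W X u (n + 1) A =ᵐ[P]
      {ω | ω ∈ noRuin c W X u n ∧ arrival W (n + 1) ω ∈ A ∧
        u + c * arrival W (n + 1) ω < claimTotal X (n + 1) ω} := by
  filter_upwards [hM.ae_interarrival_pos] with ω hω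
  exact propext (mem_ruinEvent_iff hc hu hω n A)

lemma IsModel.measurableSet_ruin (hM : IsModel P lam f W X) (u : ℝ) (n : ℕ)
    {A : Set ℝ} (hA : MeasurableSet A) : MeasurableSet
      {ω | ω ∈ noRuin c W X u n ∧ arrival W (n + 1) ω ∈ A ∧
        u + c * arrival W (n + 1) ω < claimTotal X (n + 1) ω} := by
  have ha : Measurable (arrival W (n + 1)) :=
    (measurable_past_arrival le_rfl).mono (hM.past_le (n + 1) (n + 1)) le_rfl
  have hs : Measurable (claimTotal X (n + 1)) :=
    (measurable_past_claimTotal le_rfl).mono (hM.past_le (n + 1) (n + 1)) le_rfl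
  exact (hM.measurableSet_noRuin u n).inter ((ha hA).inter
    (measurableSet_lt ((ha.const_mul c).const_add u) hs))

lemma measurable_claimLaw_Ioi (f : ℝ → ℝ) : Measurable fun x => claimLaw f (Ioi x) :=
  Antitone.measurable fun _ _ h => measure_mono (Ioi_subset_Ioi h)

/-- The claim causing ruin is independent of everything before it; integrating it out leaves a tail
probability at the current level. -/
lemma IsModel.prob_ruinEvent [IsProbabilityMeasure P] (hM : IsModel P lam f W X) (hc : 0 < c)
    {u : ℝ} (hu : 0 ≤ u) (n : ℕ) {A : Set ℝ} (hA : MeasurableSet A) :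
    P (ruinEvent c W X u (n + 1) A) = preRuin P c W X u n fun p =>
      A.indicator (fun t => claimLaw f (Ioi (u + c * t - p.2))) p.1 := by
  rw [measure_congr (hM.ruinEvent_ae_eq hc hu n A),
    ← lintegral_indicator_one (hM.measurableSet_ruin u n hA), preRuin]
  have hms : MeasurableSet {q : ((ℝ × ℝ) × ℝ≥0∞) × ℝ |
      q.1.1.1 ∈ A ∧ u + c * q.1.1.1 < q.1.1.2 + q.2} := by
    have h1 : Measurable fun q : ((ℝ × ℝ) × ℝ≥0∞) × ℝ => q.1.1.1 := by fun_prop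
    have h2 : MeasurableSet {q : ((ℝ × ℝ) × ℝ≥0∞) × ℝ | u + c * q.1.1.1 < q.1.1.2 + q.2} :=
      measurableSet_lt (by fun_prop) (by fun_prop)
    exact (h1 hA).inter h2
  have h2 := hM.lintegral_past (measurable_past_state c u (a := n + 1) (b := n) (i := n + 1)
    (j := n) (n := n) le_rfl le_rfl (Nat.le_succ n) le_rfl) (k := Sum.inr n) (by simp)
    (φ := fun q => q.1.2 * {q : ((ℝ × ℝ) × ℝ≥0∞) × ℝ |
      q.1.1.1 ∈ A ∧ u + c * q.1.1.1 < q.1.1.2 + q.2}.indicator 1 q)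
    (Measurable.mul (by fun_prop) (measurable_one.indicator hms))
  simp only [Sum.elim_inr, hM.law_claim] at h2
  refine Eq.trans ?_ (h2.trans ?_)
  · refine lintegral_congr fun ω => ?_
    by_cases ha : ω ∈ noRuin c W X u n <;> by_cases hb : arrival W (n + 1) ω ∈ A <;>
      by_cases hd : u + c * arrival W (n + 1) ω < claimTotal X n ω + X n ω <;>
      simp [indicator, ha, hb, hd, claimTotal_succ]
  · refine lintegral_congr fun ω => ?_
    rw [lintegral_const_mul]
    · congr 1
      by_cases ha : arrival W (n + 1) ω ∈ A
      · rw [indicator_of_mem ha, ← lintegral_indicator_one measurableSet_Ioi]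
        refine lintegral_congr fun x => ?_
        simp [indicator, ha, sub_lt_iff_lt_add']
      · simp [indicator, ha]
    · exact (measurable_one.indicator hms).comp (measurable_const.prodMk measurable_id)

end Chain

/-! ### The ballot theorem and the last recovery from ruin -/

section Ballot

variable {Ω : Type*} [MeasurableSpace Ω] {W X : ℕ → Ω → ℝ} {P : Measure Ω} [IsProbabilityMeasure P]
  {lam c : ℝ} {f : ℝ → ℝ}

/-- The claim half of the ballot induction, at a fixed time with b = c t. Given that n + 1 claims
total v, the first n have mean n v / (n + 1) by exchangeability, and the weight is affine in their
total. -/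
lemma lintegral_claimSum_ballot (hf : IsClaimDensity f) (n : ℕ) {g b : ℝ} (hg : 0 ≤ g) (hb : 0 < b)
    {ψ : ℝ → ℝ≥0∞} (hψ : Measurable ψ) :
    ∫⁻ v, ENNReal.ofReal (g * (1 - v / b)) *
        ∫⁻ x, (if v + x ≤ b then ψ (v + x) else 0) ∂(claimLaw f) ∂(claimSum f n) =
      ∫⁻ v, ENNReal.ofReal (g * (1 - n / (n + 1) * (v / b))) *
        (if v ≤ b then ψ v else 0) ∂(claimSum f (n + 1)) := by
  set χ : ℝ → ℝ≥0∞ := fun v => if v ≤ b then ψ v else 0 with hχ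
  have hχm : Measurable χ := Measurable.ite measurableSet_Iic hψ measurable_const
  -- Splits 1 - v / b into (1 - (v + x) / b) + x / b. Where χ(v + x) does not vanish both parts are
  -- non-negative, so the truncation in `ENNReal.ofReal` does no harm.
  have h1 : ∫⁻ v, ENNReal.ofReal (g * (1 - v / b)) * ∫⁻ x, χ (v + x) ∂(claimLaw f)
        ∂(claimSum f n) =
      (∫⁻ v, ∫⁻ x, ENNReal.ofReal (g * (1 - (v + x) / b)) * χ (v + x) ∂(claimLaw f)
        ∂(claimSum f n)) +
      ENNReal.ofReal (g / b) * ∫⁻ v, ∫⁻ x, ENNReal.ofReal x * χ (v + x) ∂(claimLaw f)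
        ∂(claimSum f n) := by
    rw [← lintegral_const_mul _ (by fun_prop), ← lintegral_add_left (by fun_prop)]
    refine lintegral_congr fun v => ?_
    rw [← lintegral_const_mul _ (by fun_prop), ← lintegral_const_mul _ (by fun_prop),
      ← lintegral_add_left (by fun_prop)]
    refine lintegral_congr_ae ?_
    filter_upwards [hf.ae_nonneg] with x hx
    by_cases hvx : v + x ≤ b
    · rw [← mul_assoc, ← add_mul, ← ENNReal.ofReal_mul (by positivity), ← ENNReal.ofReal_add]
      · congr 2
        field_simp
        ring
      · have : (v + x) / b ≤ 1 := (div_le_one hb).2 hvx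
        exact mul_nonneg hg (by linarith)
      · positivity
    · simp [hχ, hvx]
  have h2 : ∫⁻ v, ∫⁻ x, ENNReal.ofReal x * χ (v + x) ∂(claimLaw f) ∂(claimSum f n) =
      ENNReal.ofReal (1 / (n + 1)) * ∫⁻ v, ENNReal.ofReal v * χ v ∂(claimSum f (n + 1)) := by
    rw [← lintegral_claimSum_exchange hf n hχm, ← mul_assoc]
    have : ENNReal.ofReal (1 / (n + 1)) * ((n + 1 : ℕ) : ℝ≥0∞) = 1 := by
      rw [← ENNReal.ofReal_natCast, ← ENNReal.ofReal_mul (by positivity)]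
      push_cast
      rw [one_div_mul_cancel (by positivity), ENNReal.ofReal_one]
    rw [this, one_mul]
  rw [h1, h2, ← lintegral_claimSum_succ n (φ := fun v => ENNReal.ofReal (g * (1 - v / b)) * χ v)
    (by fun_prop), ← mul_assoc, ← lintegral_const_mul _ (by fun_prop),
    ← lintegral_add_left (by fun_prop)]
  refine lintegral_congr_ae ?_
  filter_upwards [ae_claimSum_nonneg hf (n + 1)] with v hv
  by_cases hvb : v ≤ b
  · have : v / b ≤ 1 := (div_le_one hb).2 hvb
    rw [← mul_assoc, ← add_mul, ← ENNReal.ofReal_mul (by positivity),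
      ← ENNReal.ofReal_mul (by positivity), ← ENNReal.ofReal_add]
    · congr 2
      field_simp
      ring
    · exact mul_nonneg hg (by linarith)
    · positivity
  · simp [hχ, hvb]

/-- The time half of the ballot induction, with the claim total v fixed. The primitive of the weight
is proportional to t^(n+1) - (v / c) t^n. It vanishes at t = v / c, the earliest admissible time,
and this reproduces the factor 1 - v / (c t). -/
lemma lintegral_waiting_ballot (hlam : 0 ≤ lam) (hc : 0 < c) (n : ℕ) {v : ℝ} (hv : 0 ≤ v)
    {H : ℝ → ℝ≥0∞} (hH : Measurable H) :
    ∫⁻ t in Ioi 0, ENNReal.ofReal (lam * poissonWeight lam n t * (1 - n / (n + 1) * (v / (c * t)))) *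
        (if v ≤ c * t then ∫⁻ s, H (t + s) ∂(expMeasure lam) else 0) =
      ∫⁻ t in Ioi 0, ENNReal.ofReal (lam * poissonWeight lam (n + 1) t * (1 - v / (c * t))) * H t := by
  have ha : 0 ≤ v / c := by positivity
  have hiff : ∀ t, v ≤ c * t ↔ v / c ≤ t := fun t => by rw [div_le_iff₀ hc, mul_comm]
  have hpow : ∀ t, HasDerivAt (fun t : ℝ => t ^ n) (n * t ^ (n - 1)) t := fun t => hasDerivAt_pow n t
  have hstep := lintegral_add_waiting (lam := lam) hlam (a := v / c)
    (g := fun t => lam ^ (n + 1) / (n + 1).factorial *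
      ((n + 1) * t ^ n - v / c * (n * t ^ (n - 1))))
    (G := fun t => lam ^ (n + 1) / (n + 1).factorial * (t ^ (n + 1) - v / c * t ^ n))
    (by fun_prop)
    (fun t => by
      have := ((hasDerivAt_pow (n + 1) t).sub ((hpow t).const_mul (v / c))).const_mul
        (lam ^ (n + 1) / ((n + 1).factorial : ℝ))
      simpa using this)
    (fun t ht => by
      have ht0 : 0 ≤ t := ha.trans ht.le
      refine mul_nonneg (by positivity) ?_
      rcases n with _ | m
      · simp
      · have h1 : v / c * t ^ m ≤ t * t ^ m := by gcongr
        have h2 : 0 ≤ t ^ (m + 1) := by positivity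
        have h3 : ((m + 1 : ℕ) : ℝ) * (v / c * t ^ m) ≤ ((m + 1 : ℕ) : ℝ) * (t * t ^ m) := by gcongr
        simp only [Nat.add_sub_cancel]
        rw [pow_succ] at h2 ⊢
        linarith) hH
  have hGa : lam ^ (n + 1) / (n + 1).factorial * ((v / c) ^ (n + 1) - v / c * (v / c) ^ n) = 0 := by
    ring
  simp only [hGa, sub_zero] at hstep
  have hfac : ((n + 1).factorial : ℝ) = (n + 1) * n.factorial := by
    rw [Nat.factorial_succ]; push_cast; ring
  have hn0 : (n.factorial : ℝ) ≠ 0 := by positivity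
  have hn1 : (n + 1 : ℝ) ≠ 0 := by positivity
  have h0 : ∀ᵐ s : ℝ, s ≠ v / c := by simp [ae_iff]
  -- Both sides of the lemma vanish for t < v / c: the left by its case distinction, the right
  -- because `ENNReal.ofReal` truncates a non-positive weight.
  have key : ∀ φ ψ : ℝ → ℝ≥0∞, (∀ t, v / c < t → φ t = ψ t) → (∀ t, 0 < t → t < v / c → φ t = 0) →
      ∫⁻ t in Ioi 0, φ t = ∫⁻ t in Ioi (v / c), ψ t := by
    intro φ ψ h1 h2
    rw [← lintegral_indicator measurableSet_Ioi, ← lintegral_indicator measurableSet_Ioi]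
    refine lintegral_congr_ae ?_
    filter_upwards [h0] with t ht
    rcases lt_or_gt_of_ne ht with h | h
    · by_cases ht0 : 0 < t
      · simp [indicator, h.not_gt, h2 t ht0 h]
      · simp [indicator, h.not_gt, ht0]
    · simp [indicator, h, ha.trans_lt h, h1 t h]
  refine Eq.trans ?_ (hstep.trans ?_)
  · refine key _ _ (fun t ht => ?_) fun t _ ht => ?_
    · have ht0 : 0 < t := ha.trans_lt ht
      rw [if_pos ((hiff t).2 ht.le)]
      congr 2
      rw [poissonWeight, hfac]
      rcases n with _ | m
      · simp
      · simp only [Nat.add_sub_cancel]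
        push_cast
        field_simp
        ring
    · rw [if_neg ((hiff t).not.2 ht.not_ge), mul_zero]
  · refine (key _ _ (fun t ht => ?_) fun t ht0 ht => ?_).symm
    · have ht0 : 0 < t := ha.trans_lt ht
      congr 2
      rw [poissonWeight]
      field_simp
      ring
    · rw [ENNReal.ofReal_of_nonpos, zero_mul]
      refine mul_nonpos_of_nonneg_of_nonpos
        (mul_nonneg hlam (poissonWeight_nonneg hlam _ ht0.le)) ?_
      have : 1 ≤ v / (c * t) := by
        rw [one_le_div (by positivity)]
        exact (lt_of_not_ge fun h => ht.not_ge ((hiff t).1 h)).le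
      linarith

lemma measurable_ite_level (u : ℝ) {h : ℝ × ℝ → ℝ≥0∞} (hh : Measurable h) :
    Measurable fun p : ℝ × ℝ => if p.2 ≤ u + c * p.1 then h p else 0 :=
  Measurable.ite (measurableSet_le (by fun_prop) (by fun_prop)) hh measurable_const

/-- The ballot theorem: without initial capital, given that the `n + 1`-st claim arrives at time `t`
and the first `n` claims amount to `v ≤ c * t`, these do not cause ruin with probability
`1 - v / (c * t)`. -/
theorem IsModel.preRuin_ballot (hM : IsModel P lam f W X) (hf : IsClaimDensity f) (hlam : 0 ≤ lam)
    (hc : 0 < c) (n : ℕ) {h : ℝ × ℝ → ℝ≥0∞} (hh : Measurable h) :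
    preRuin P c W X 0 n h =
      ∫⁻ t in Ioi 0, ∫⁻ v, ENNReal.ofReal (lam * poissonWeight lam n t * (1 - v / (c * t))) *
        h (t, v) ∂(claimSum f n) := by
  induction n generalizing h with
  | zero =>
    rw [hM.preRuin_zero le_rfl hh, lintegral_expMeasure lam (by fun_prop)]
    refine lintegral_congr fun t => ?_
    rw [claimSum, lintegral_dirac' _ (by fun_prop)]
    simp [poissonWeight]
  | succ n ih =>
    have hΦ : Measurable fun p : ℝ × ℝ => ∫⁻ s, h (p.1 + s, p.2) ∂(expMeasure lam) := by fun_prop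
    have hite := measurable_ite_level (c := c) 0 hΦ
    simp only [zero_add] at hite
    rw [hM.preRuin_succ 0 n hh, ih (by fun_prop)]
    calc _ = ∫⁻ t in Ioi 0, ∫⁻ v, ENNReal.ofReal
            (lam * poissonWeight lam n t * (1 - n / (n + 1) * (v / (c * t)))) *
            (if v ≤ c * t then ∫⁻ s, h (t + s, v) ∂(expMeasure lam) else 0)
            ∂(claimSum f (n + 1)) := by
          refine setLIntegral_congr_fun measurableSet_Ioi fun t (ht : 0 < t) => ?_
          simp only [stepOp, zero_add]
          exact lintegral_claimSum_ballot hf n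
            (mul_nonneg hlam (poissonWeight_nonneg hlam n ht.le)) (mul_pos hc ht)
            (ψ := fun v => ∫⁻ s, h (t + s, v) ∂(expMeasure lam)) (by fun_prop)
      _ = ∫⁻ v, (∫⁻ t in Ioi 0, ENNReal.ofReal
            (lam * poissonWeight lam n t * (1 - n / (n + 1) * (v / (c * t)))) *
            (if v ≤ c * t then ∫⁻ s, h (t + s, v) ∂(expMeasure lam) else 0))
            ∂(claimSum f (n + 1)) :=
          lintegral_lintegral_swap (Measurable.mul (by fun_prop) hite).aemeasurable
      _ = ∫⁻ v, (∫⁻ t in Ioi 0, ENNReal.ofReal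
            (lam * poissonWeight lam (n + 1) t * (1 - v / (c * t))) * h (t, v))
            ∂(claimSum f (n + 1)) := by
          refine lintegral_congr_ae ?_
          filter_upwards [ae_claimSum_nonneg hf (n + 1)] with v hv
          exact lintegral_waiting_ballot hlam hc n hv (H := fun t => h (t, v)) (by fun_prop)
      _ = _ := lintegral_lintegral_swap (by unfold Function.uncurry; fun_prop)

/-- The probability of `j` claims up to the time `τ`, set to zero unless `τ` is positive. -/
noncomputable def crossWeight (lam : ℝ) (j : ℕ) (τ : ℝ) : ℝ≥0∞ :=
  if 0 < τ then ENNReal.ofReal (poissonWeight lam j τ) else 0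

@[fun_prop]
lemma measurable_crossWeight (lam : ℝ) (j : ℕ) : Measurable (crossWeight lam j) :=
  Measurable.ite measurableSet_Ioi (by fun_prop) measurable_const

/-- The decomposition of the paths which are non-negative immediately before the `n + 1`-st claim
according to the last time at which they recover from ruin. -/
theorem IsModel.preRuin_add_lastRecovery (hM : IsModel P lam f W X) (hf : IsClaimDensity f)
    (hlam : 0 ≤ lam) (hc : 0 < c) {u : ℝ} (hu : 0 ≤ u) (n : ℕ) {h : ℝ × ℝ → ℝ≥0∞}
    (hh : Measurable h) :
    ∫⁻ t in Ioi 0, ∫⁻ v, ENNReal.ofReal (lam * poissonWeight lam n t) *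
        (if v ≤ u + c * t then h (t, v) else 0) ∂(claimSum f n) =
      preRuin P c W X u n h + ∑ j ∈ Finset.Icc 1 n, ∫⁻ v, crossWeight lam j ((v - u) / c) *
        preRuin P c W X 0 (n - j) (fun p => h (p.1 + (v - u) / c, p.2 + v)) ∂(claimSum f j) := by
  have hlev : ∀ {h : ℝ × ℝ → ℝ≥0∞}, Measurable h → ∀ t,
      Measurable fun v => if v ≤ u + c * t then h (t, v) else 0 := fun hh t =>
    (measurable_ite_level (c := c) u hh).comp measurable_prodMk_left
  have hswap : ∀ {h : ℝ × ℝ → ℝ≥0∞}, Measurable h → ∀ k m,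
      ∫⁻ t in Ioi 0, ∫⁻ v, ENNReal.ofReal (lam * poissonWeight lam k t) *
          (if v ≤ u + c * t then h (t, v) else 0) ∂(claimSum f m) =
        ∫⁻ v, (∫⁻ t in Ioi 0, ENNReal.ofReal (lam * poissonWeight lam k t) *
          (if v ≤ u + c * t then h (t, v) else 0)) ∂(claimSum f m) := fun hh k m =>
    lintegral_lintegral_swap
      (Measurable.mul (by fun_prop) (measurable_ite_level (c := c) u hh)).aemeasurable
  induction n generalizing h with
  | zero =>
    rw [hM.preRuin_zero hu hh, lintegral_expMeasure lam (by fun_prop)]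
    simp only [Finset.Icc_eq_empty_of_lt zero_lt_one, Finset.sum_empty, add_zero]
    refine setLIntegral_congr_fun measurableSet_Ioi fun t (ht : 0 < t) => ?_
    have : 0 ≤ u + c * t := by positivity
    simp only [claimSum]
    rw [lintegral_dirac' _ ((hlev hh t).const_mul _)]
    simp [poissonWeight, this]
  | succ n ih =>
    have hΦ : Measurable fun p : ℝ × ℝ => ∫⁻ s, h (p.1 + s, p.2) ∂(expMeasure lam) := by fun_prop
    have hiff : ∀ v t, v ≤ u + c * t ↔ (v - u) / c ≤ t := fun v t => by
      rw [div_le_iff₀ hc, mul_comm t, sub_le_iff_le_add']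
    have hlast : ∫⁻ v, crossWeight lam (n + 1) ((v - u) / c) *
          ∫⁻ s, h (s + (v - u) / c, v) ∂(expMeasure lam) ∂(claimSum f (n + 1)) =
        ∫⁻ v, crossWeight lam (n + 1) ((v - u) / c) *
          preRuin P c W X 0 (n + 1 - (n + 1)) (fun p => h (p.1 + (v - u) / c, p.2 + v))
          ∂(claimSum f (n + 1)) := by
      refine lintegral_congr fun v => ?_
      rw [Nat.sub_self, hM.preRuin_zero le_rfl (by fun_prop)]
      simp
    -- Claims are non-negative, so the level condition after the claim implies the one before it.
    -- Inserting the latter costs nothing and gives the form required by the induction hypothesis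
    -- for `stepOp`.
    have hprev : ∫⁻ v, (∫⁻ t in Ioi 0, ENNReal.ofReal (lam * poissonWeight lam n t) *
          (if v ≤ u + c * t then ∫⁻ s, h (t + s, v) ∂(expMeasure lam) else 0))
          ∂(claimSum f (n + 1)) =
        ∫⁻ t in Ioi 0, ∫⁻ v, ENNReal.ofReal (lam * poissonWeight lam n t) *
          (if v ≤ u + c * t then stepOp c lam f u h (t, v) else 0) ∂(claimSum f n) := by
      rw [← hswap hΦ]
      refine lintegral_congr fun t => ?_
      have hx : ∀ v, Measurable fun x => if v + x ≤ u + c * t then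
          ∫⁻ s, h (t + s, v + x) ∂(expMeasure lam) else 0 := fun v =>
        (hlev hΦ t).comp (measurable_const_add v)
      rw [lintegral_claimSum_succ _ ((hlev hΦ t).const_mul _)]
      refine lintegral_congr fun v => ?_
      rw [lintegral_const_mul _ (hx v)]
      congr 1
      split_ifs with hv
      · rfl
      · rw [lintegral_eq_zero_iff (hx v)]
        filter_upwards [hf.ae_nonneg] with x hx
        rw [if_neg (by linarith)]
        rfl
    calc _ = ∫⁻ v, (∫⁻ t in Ioi 0, ENNReal.ofReal (lam * poissonWeight lam (n + 1) t) *
          (if v ≤ u + c * t then h (t, v) else 0)) ∂(claimSum f (n + 1)) :=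
          hswap hh _ _
      _ = ∫⁻ v, ((∫⁻ t in Ioi 0, ENNReal.ofReal (lam * poissonWeight lam n t) *
            (if v ≤ u + c * t then ∫⁻ s, h (t + s, v) ∂(expMeasure lam) else 0)) +
            crossWeight lam (n + 1) ((v - u) / c) *
              ∫⁻ s, h (s + (v - u) / c, v) ∂(expMeasure lam)) ∂(claimSum f (n + 1)) := by
          refine lintegral_congr fun v => ?_
          simp only [hiff]
          exact lintegral_arrival_split hlam n _ (H := fun t => h (t, v)) (by fun_prop)
      _ = _ := by
          rw [lintegral_add_right _ (by fun_prop), hprev, ih (by fun_prop), hlast,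
            ← hM.preRuin_succ u n hh, Finset.sum_Icc_succ_top (by omega), add_assoc]
          congr 2
          refine Finset.sum_congr rfl fun j hj => ?_
          have hj' : n + 1 - j = (n - j) + 1 := by
            have := (Finset.mem_Icc.1 hj).2
            omega
          refine lintegral_congr fun v => ?_
          rw [hj', hM.preRuin_succ 0 (n - j) (by fun_prop)]
          congr 2
          ext p
          simp only [stepOp]
          refine lintegral_congr fun x => ?_
          -- At τ = (v - u) / c the level u + c τ - v is 0, so killing the shifted path at ruin is
          -- killing without initial capital.
          have : p.2 + v + x ≤ u + c * (p.1 + (v - u) / c) ↔ p.2 + x ≤ 0 + c * p.1 := by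
            rw [mul_add, mul_div_cancel₀ _ hc.ne']
            constructor <;> intro h <;> linarith
          simp only [this, add_right_comm]

end Ballot

/-! ### Densities -/

section Convolution

variable {f : ℝ → ℝ}

/-- The form over the whole line, needed for Tonelli and translation invariance. For t < 0 both
integrals vanish. -/
lemma conv_eq_integral {g h : ℝ → ℝ} (hg : ∀ x, x < 0 → g x = 0) (hh : ∀ x, x < 0 → h x = 0)
    (t : ℝ) : conv g h t = ∫ x, g x * h (t - x) := by
  have h0 : ∀ᵐ s : ℝ, s ≠ 0 := by simp [ae_iff]
  rcases le_or_gt 0 t with ht | ht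
  · rw [conv, intervalIntegral.integral_of_le ht]
    refine setIntegral_eq_integral_of_ae_compl_eq_zero ?_
    filter_upwards [h0] with x hx hxt
    rcases lt_or_gt_of_ne hx with h | h
    · rw [hg x h, zero_mul]
    · have : t < x := by
        by_contra! h'
        exact hxt ⟨h, h'⟩
      rw [hh _ (by linarith), mul_zero]
  · have h1 : ∫ x, g x * h (t - x) = 0 := by
      rw [← integral_zero ℝ ℝ]
      refine integral_congr_ae (.of_forall fun x => ?_)
      rcases lt_or_ge x 0 with hx | hx
      · simp [hg x hx]
      · simp [hh (t - x) (by linarith)]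
    rw [conv, h1]
    refine intervalIntegral.integral_zero_ae ?_
    filter_upwards [h0] with x hx hxt
    rw [uIoc_of_ge ht.le] at hxt
    rw [hg x (lt_of_le_of_ne hxt.2 hx), zero_mul]

lemma measurable_conv {g h : ℝ → ℝ} (hgm : Measurable g) (hhm : Measurable h)
    (hg : ∀ x, x < 0 → g x = 0) (hh : ∀ x, x < 0 → h x = 0) : Measurable (conv g h) := by
  rw [funext (conv_eq_integral hg hh)]
  have : StronglyMeasurable fun p : ℝ × ℝ => g p.2 * h (p.1 - p.2) :=
    Measurable.stronglyMeasurable (by fun_prop)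
  exact this.integral_prod_right.measurable

lemma convPow_aux (hf : IsClaimDensity f) (n : ℕ) : Measurable (convPow f (n + 1)) ∧
    (∀ x, 0 ≤ convPow f (n + 1) x) ∧ ∀ x, x < 0 → convPow f (n + 1) x = 0 := by
  induction n with
  | zero => exact ⟨hf.measurable, hf.nonneg, hf.eq_zero_of_neg⟩
  | succ n ih =>
    refine ⟨measurable_conv ih.1 hf.measurable ih.2.2 hf.eq_zero_of_neg, fun x => ?_, fun x hx => ?_⟩
    · rw [convPow, conv_eq_integral ih.2.2 hf.eq_zero_of_neg]
      exact integral_nonneg fun y => mul_nonneg (ih.2.1 y) (hf.nonneg _)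
    · rw [convPow, conv_eq_integral ih.2.2 hf.eq_zero_of_neg, ← integral_zero ℝ ℝ]
      refine integral_congr_ae (.of_forall fun y => ?_)
      rcases lt_or_ge y 0 with hy | hy
      · simp [ih.2.2 y hy]
      · simp [hf.eq_zero_of_neg (x - y) (by linarith)]

lemma IsClaimDensity.measurable_convPow (hf : IsClaimDensity f) {n : ℕ} (hn : 1 ≤ n) :
    Measurable (convPow f n) := by
  obtain ⟨n, rfl⟩ := Nat.exists_eq_add_of_le' hn
  exact (convPow_aux hf n).1

lemma IsClaimDensity.convPow_nonneg (hf : IsClaimDensity f) {n : ℕ} (hn : 1 ≤ n) (x : ℝ) :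
    0 ≤ convPow f n x := by
  obtain ⟨n, rfl⟩ := Nat.exists_eq_add_of_le' hn
  exact (convPow_aux hf n).2.1 x

lemma IsClaimDensity.convPow_of_neg (hf : IsClaimDensity f) {n : ℕ} (hn : 1 ≤ n) {x : ℝ}
    (hx : x < 0) : convPow f n x = 0 := by
  obtain ⟨n, rfl⟩ := Nat.exists_eq_add_of_le' hn
  exact (convPow_aux hf n).2.2 x hx

/-- The `n`-fold convolution of the density is a density of the sum of `n` claims. -/
lemma claimSum_eq_withDensity (hf : IsClaimDensity f) {n : ℕ} (hn : 1 ≤ n) :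
    claimSum f n = volume.withDensity fun x => ENNReal.ofReal (convPow f n x) := by
  induction n, hn using Nat.le_induction with
  | base => rw [claimSum, claimSum, Measure.dirac_zero_conv]; rfl
  | succ n hn ih =>
    have hm := hf.measurable_convPow hn
    have hfm := hf.measurable
    have h1 : ∀ φ : ℝ → ℝ≥0∞, Measurable φ → ∫⁻ v, φ v ∂(claimSum f (n + 1)) =
        ∫⁻ y, (∫⁻ x, ENNReal.ofReal (convPow f n x * f (y - x))) * φ y := by
      intro φ hφ
      rw [lintegral_claimSum_succ n hφ, ih,
        lintegral_withDensity_eq_lintegral_mul _ (by fun_prop) (by fun_prop)]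
      have h2 : ∀ v, ((fun x => ENNReal.ofReal (convPow f n x)) *
          fun v => ∫⁻ x, φ (v + x) ∂(claimLaw f)) v =
          ∫⁻ y, ENNReal.ofReal (convPow f n v * f (y - v)) * φ y := by
        intro v
        rw [Pi.mul_apply, claimLaw,
          lintegral_withDensity_eq_lintegral_mul _ (by fun_prop) (by fun_prop),
          ← lintegral_const_mul _ (by fun_prop), ← lintegral_add_left_eq_self
            (fun y => ENNReal.ofReal (convPow f n v * f (y - v)) * φ y) v]
        refine lintegral_congr fun x => ?_
        rw [Pi.mul_apply, ← mul_assoc, ← ENNReal.ofReal_mul (hf.convPow_nonneg hn v),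
          add_sub_cancel_left]
      simp_rw [h2]
      rw [lintegral_lintegral_swap (by unfold Function.uncurry; fun_prop)]
      refine lintegral_congr fun y => ?_
      rw [lintegral_mul_const _ (by fun_prop)]
    -- The total mass is 1, so the convolution integral is finite almost everywhere; elsewhere the
    -- Bochner integral in `conv` has the default value 0.
    have hfin : ∀ᵐ y, ∫⁻ x, ENNReal.ofReal (convPow f n x * f (y - x)) < ∞ := by
      have := isProbabilityMeasure_claimSum hf (n + 1)
      have h3 := h1 1 measurable_one
      simp only [Pi.one_apply, lintegral_one, measure_univ, mul_one] at h3
      exact ae_lt_top (by fun_prop) (by rw [← h3]; simp)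
    refine Measure.ext_of_lintegral _ fun φ hφ => ?_
    have hm' := hf.measurable_convPow (n := n + 1) (by omega)
    rw [h1 φ hφ, lintegral_withDensity_eq_lintegral_mul _ (by fun_prop) hφ]
    refine lintegral_congr_ae ?_
    filter_upwards [hfin] with y hy
    have h4 : convPow f (n + 1) y = ∫ x, convPow f n x * f (y - x) := by
      obtain ⟨m, rfl⟩ := Nat.exists_eq_add_of_le' hn
      exact conv_eq_integral (fun x hx => hf.convPow_of_neg hn hx) hf.eq_zero_of_neg y
    rw [Pi.mul_apply, h4, integral_eq_lintegral_of_nonneg_ae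
      (.of_forall fun x => mul_nonneg (hf.convPow_nonneg hn x) (hf.nonneg _))
      (by fun_prop), ENNReal.ofReal_toReal hy.ne]

lemma lintegral_claimSum (hf : IsClaimDensity f) {n : ℕ} (hn : 1 ≤ n) {φ : ℝ → ℝ≥0∞}
    (hφ : Measurable φ) :
    ∫⁻ v, φ v ∂(claimSum f n) = ∫⁻ v, ENNReal.ofReal (convPow f n v) * φ v := by
  have := hf.measurable_convPow hn
  rw [claimSum_eq_withDensity hf hn, lintegral_withDensity_eq_lintegral_mul _ (by fun_prop) hφ]
  rfl

lemma IsClaimDensity.integrable (hf : IsClaimDensity f) : Integrable f :=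
  ⟨hf.measurable.aestronglyMeasurable, by
    rw [hasFiniteIntegral_iff_ofReal (.of_forall hf.nonneg), hf.lintegral_eq_one]
    exact ENNReal.one_lt_top⟩

lemma claimLaw_Ioi (hf : IsClaimDensity f) (x : ℝ) :
    claimLaw f (Ioi x) = ENNReal.ofReal (tail f x) := by
  rw [claimLaw, withDensity_apply _ measurableSet_Ioi, tail,
    ofReal_integral_eq_lintegral_ofReal hf.integrable.integrableOn (.of_forall hf.nonneg)]

lemma tail_nonneg (hf : IsClaimDensity f) (x : ℝ) : 0 ≤ tail f x :=
  integral_nonneg hf.nonneg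

lemma measurable_tail (hf : IsClaimDensity f) : Measurable (tail f) := by
  have : tail f = fun x => (claimLaw f (Ioi x)).toReal := by
    ext x
    rw [claimLaw_Ioi hf, ENNReal.toReal_ofReal (tail_nonneg hf x)]
  rw [this]
  exact (measurable_claimLaw_Ioi f).ennreal_toReal

end Convolution

lemma measurable_lintegral_Ioo {φ : ℝ → ℝ → ℝ≥0∞} (hφ : Measurable (Function.uncurry φ)) (a : ℝ) :
    Measurable fun r => ∫⁻ t in Ioo a r, φ t r := by
  have hs : MeasurableSet {p : ℝ × ℝ | a < p.1 ∧ p.1 < p.2} :=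
    (measurableSet_lt measurable_const measurable_fst).inter
      (measurableSet_lt measurable_fst measurable_snd)
  simp_rw [lintegral_Ioo_eq_indicator]
  exact (hφ.indicator hs).lintegral_prod_left'

lemma lintegral_comp_affine {c : ℝ} (hc : 0 < c) (u : ℝ) {φ : ℝ → ℝ≥0∞} (hφ : Measurable φ) :
    ∫⁻ v, φ v = ∫⁻ s, ENNReal.ofReal c * φ (u + c * s) := by
  rw [lintegral_const_mul _ (by fun_prop), ← lintegral_add_left_eq_self φ u,
    ← lintegral_map (f := fun v => φ (u + v)) (g := fun s => c * s) (by fun_prop) (by fun_prop),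
    Real.map_volume_mul_left hc.ne', lintegral_smul_measure, smul_eq_mul, ← mul_assoc,
    abs_of_pos (by positivity), ← ENNReal.ofReal_mul hc.le, mul_inv_cancel₀ hc.ne']
  simp

/-- A non-negative function on a bounded interval with a finite `lintegral`. -/
lemma intervalIntegral_of_lintegral_ne_top {b : ℝ} (hb : 0 ≤ b) {g : ℝ → ℝ} (hg : Measurable g)
    (hpos : ∀ x, 0 < x → 0 ≤ g x) (hfin : ∫⁻ x in Ioo 0 b, ENNReal.ofReal (g x) ≠ ∞) :
    IntervalIntegrable g volume 0 b ∧
      ∫ x in (0 : ℝ)..b, g x = (∫⁻ x in Ioo 0 b, ENNReal.ofReal (g x)).toReal := by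
  rw [setLIntegral_congr Ioo_ae_eq_Ioc] at hfin ⊢
  have hae : ∀ᵐ x ∂(volume.restrict (Ioc 0 b)), 0 ≤ g x :=
    (ae_restrict_iff' measurableSet_Ioc).2 (.of_forall fun x hx => hpos x hx.1)
  constructor
  · rw [intervalIntegrable_iff_integrableOn_Ioc_of_le hb]
    exact ⟨hg.aestronglyMeasurable, by
      rw [hasFiniteIntegral_iff_ofReal hae]
      exact hfin.lt_top⟩
  · rw [intervalIntegral.integral_of_le hb,
      integral_eq_lintegral_of_nonneg_ae hae hg.aestronglyMeasurable]

/-! ### The joint density of the ruin time and the number of claims until ruin -/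

section JointDensity

variable {Ω : Type*} [MeasurableSpace Ω] {W X : ℕ → Ω → ℝ} {P : Measure Ω} {lam c : ℝ} {f : ℝ → ℝ}

/-- The probability that a claim at time `t` causes ruin, if the total of the previous claims is
`p.2`, integrated over the event that the time `t` belongs to `A`. -/
noncomputable def ruinPayoff (c : ℝ) (f : ℝ → ℝ) (u : ℝ) (A : Set ℝ) (p : ℝ × ℝ) : ℝ≥0∞ :=
  A.indicator (fun t => claimLaw f (Ioi (u + c * t - p.2))) p.1

lemma measurable_ruinPayoff (u : ℝ) {A : Set ℝ} (hA : MeasurableSet A) :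
    Measurable (ruinPayoff c f u A) := by
  have h1 : Measurable fun p : ℝ × ℝ => claimLaw f (Ioi (u + c * p.1 - p.2)) :=
    (measurable_claimLaw_Ioi f).comp (by fun_prop)
  exact h1.indicator (measurable_fst hA)

/-- The density of the time of the `n + 1`-st claim on the event that the level is non-negative
before and negative after this claim. -/
noncomputable def downcrossDensity (lam c : ℝ) (f : ℝ → ℝ) (u : ℝ) (n : ℕ) (t : ℝ) : ℝ≥0∞ :=
  ∫⁻ v, ENNReal.ofReal (lam * poissonWeight lam n t) *
    (if v ≤ u + c * t then claimLaw f (Ioi (u + c * t - v)) else 0) ∂(claimSum f n)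

lemma measurable_downcross (n : ℕ) (u : ℝ) : Measurable fun p : ℝ × ℝ =>
    ENNReal.ofReal (lam * poissonWeight lam n p.1) *
      (if p.2 ≤ u + c * p.1 then claimLaw f (Ioi (u + c * p.1 - p.2)) else 0) :=
  Measurable.mul (by fun_prop) (measurable_ite_level u
    ((measurable_claimLaw_Ioi f).comp (by fun_prop :
      Measurable fun p : ℝ × ℝ => u + c * p.1 - p.2)))

lemma measurable_downcrossDensity (u : ℝ) (n : ℕ) :
    Measurable (downcrossDensity lam c f u n) :=
  Measurable.lintegral_prod_right' (measurable_downcross (c := c) (f := f) (lam := lam) n u)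

lemma lintegral_downcross (u : ℝ) (n : ℕ) {A : Set ℝ} (hA : MeasurableSet A) :
    ∫⁻ t in Ioi 0, ∫⁻ v, ENNReal.ofReal (lam * poissonWeight lam n t) *
        (if v ≤ u + c * t then ruinPayoff c f u A (t, v) else 0) ∂(claimSum f n) =
      ∫⁻ t in A ∩ Ioi 0, downcrossDensity lam c f u n t := by
  rw [← Measure.restrict_restrict hA, ← lintegral_indicator hA]
  refine lintegral_congr fun t => ?_
  by_cases ht : t ∈ A <;> simp [ruinPayoff, downcrossDensity, ht]

lemma downcrossDensity_lt_top (hf : IsClaimDensity f) (u : ℝ) (n : ℕ) (t : ℝ) :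
    downcrossDensity lam c f u n t < ∞ := by
  have := isProbabilityMeasure_claimSum hf n
  have := hf.isProbabilityMeasure
  calc _ ≤ ∫⁻ _, ENNReal.ofReal (lam * poissonWeight lam n t) ∂(claimSum f n) := by
        refine lintegral_mono fun v => ?_
        refine mul_le_of_le_one_right' ?_
        split_ifs
        exacts [prob_le_one, zero_le]
    _ < ∞ := by simp

lemma IsModel.nullMeasurableSet_ruinEvent (hM : IsModel P lam f W X) (hc : 0 < c) {u : ℝ}
    (hu : 0 ≤ u) {n : ℕ} (hn : 1 ≤ n) {A : Set ℝ} (hA : MeasurableSet A) :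
    NullMeasurableSet (ruinEvent c W X u n A) P := by
  obtain ⟨n, rfl⟩ := Nat.exists_eq_add_of_le' hn
  exact (hM.measurableSet_ruin u n hA).nullMeasurableSet.congr (hM.ruinEvent_ae_eq hc hu n A).symm

variable {w : ℝ → ℕ → ℝ → ℝ}

/-- The density of the time of a ruin which happens with the `m`-th claim after the last recovery,
where the last recovery happens after `j` claims. -/
noncomputable def recoveryDensity (lam c : ℝ) (f : ℝ → ℝ) (w : ℝ → ℕ → ℝ → ℝ) (u : ℝ) (j m : ℕ)
    (t : ℝ) : ℝ≥0∞ :=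
  ∫⁻ s in Ioo 0 t, ENNReal.ofReal c *
    ENNReal.ofReal (poissonWeight lam j s * convPow f j (u + c * s) * w 0 m (t - s))

lemma IsJointDensity.measurable_recovery (hw : IsJointDensity P c W X w) (hf : IsClaimDensity f)
    (u : ℝ) {j m : ℕ} (hj : 1 ≤ j) (hm : 1 ≤ m) : Measurable fun p : ℝ × ℝ =>
      poissonWeight lam j p.1 * convPow f j (u + c * p.1) * w 0 m (p.2 - p.1) := by
  have := hw.measurable 0 le_rfl m hm
  have := hf.measurable_convPow hj
  fun_prop

lemma IsJointDensity.measurable_recoveryDensity (hw : IsJointDensity P c W X w)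
    (hf : IsClaimDensity f) (u : ℝ) {j m : ℕ} (hj : 1 ≤ j) (hm : 1 ≤ m) :
    Measurable (recoveryDensity lam c f w u j m) :=
  measurable_lintegral_Ioo (φ := fun s t => ENNReal.ofReal c *
    ENNReal.ofReal (poissonWeight lam j s * convPow f j (u + c * s) * w 0 m (t - s)))
    ((hw.measurable_recovery (lam := lam) (c := c) hf u hj hm).ennreal_ofReal.const_mul _) 0

variable [IsProbabilityMeasure P]

/-- The last-recovery decomposition bounds the law of the ruin time by a measure with a density,
without presupposing one for ruin itself; Radon–Nikodym then applies. -/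
lemma IsModel.exists_density (hM : IsModel P lam f W X) (hf : IsClaimDensity f) (hlam : 0 < lam)
    (hc : 0 < c) {u : ℝ} (hu : 0 ≤ u) (n : ℕ) :
    ∃ w : ℝ → ℝ, Measurable w ∧ (∀ t, 0 ≤ w t) ∧ ∀ A, MeasurableSet A →
      P (ruinEvent c W X u (n + 1) A) = ∫⁻ t in A ∩ Ioi 0, ENNReal.ofReal (w t) := by
  have hT : Measurable (arrival W (n + 1)) :=
    (measurable_past_arrival le_rfl).mono (hM.past_le (n + 1) (n + 1)) le_rfl
  set μ := (P.restrict {ω | ω ∈ noRuin c W X u n ∧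
    u + c * arrival W (n + 1) ω < claimTotal X (n + 1) ω}).map (arrival W (n + 1)) with hμ
  have hμA : ∀ A, MeasurableSet A → P (ruinEvent c W X u (n + 1) A) = μ A := by
    intro A hA
    rw [measure_congr (hM.ruinEvent_ae_eq hc hu n A), hμ, Measure.map_apply hT hA,
      Measure.restrict_apply (hT hA)]
    congr 1
    ext ω
    simp only [mem_ofPred_eq, mem_inter_iff, mem_preimage]
    tauto
  have hac : μ ≪ volume.restrict (Ioi 0) := by
    refine Measure.AbsolutelyContinuous.mk fun A hA hA0 => ?_
    rw [← hμA A hA, hM.prob_ruinEvent hc hu n hA]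
    have h1 := hM.preRuin_add_lastRecovery hf hlam.le hc hu n
      (measurable_ruinPayoff (c := c) (f := f) u hA)
    rw [lintegral_downcross u n hA, ← Measure.restrict_restrict hA, setLIntegral_measure_zero _ _ hA0]
      at h1
    exact (add_eq_zero.1 h1.symm).1
  refine ⟨fun t => (μ.rnDeriv (volume.restrict (Ioi 0)) t).toReal,
    (Measure.measurable_rnDeriv _ _).ennreal_toReal, fun t => ENNReal.toReal_nonneg, fun A hA => ?_⟩
  rw [hμA A hA, ← Measure.restrict_restrict hA, ← Measure.setLIntegral_rnDeriv hac]
  refine lintegral_congr_ae (ae_restrict_of_ae ?_)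
  filter_upwards [Measure.rnDeriv_lt_top μ (volume.restrict (Ioi 0))] with t ht
  rw [ENNReal.ofReal_toReal ht.ne]

lemma IsModel.exists_isJointDensity (hM : IsModel P lam f W X) (hf : IsClaimDensity f)
    (hlam : 0 < lam) (hc : 0 < c) : ∃ w, IsJointDensity P c W X w := by
  have h : ∀ u n, ∃ w : ℝ → ℝ, 0 ≤ u → 1 ≤ n → Measurable w ∧ (∀ t, 0 ≤ w t) ∧
      ∀ A, MeasurableSet A →
        P (ruinEvent c W X u n A) = ∫⁻ t in A ∩ Ioi 0, ENNReal.ofReal (w t) := by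
    intro u n
    by_cases hu : 0 ≤ u
    · rcases n with _ | n
      · exact ⟨0, fun _ h => absurd h (by omega)⟩
      · obtain ⟨w, hw⟩ := hM.exists_density hf hlam hc hu n
        exact ⟨w, fun _ _ => hw⟩
    · exact ⟨0, fun h => absurd h hu⟩
  choose w hw using h
  exact ⟨w, fun u hu n hn => (hw u n hu hn).1, fun u hu n hn => (hw u n hu hn).2.1,
    fun u hu n hn => (hw u n hu hn).2.2⟩

lemma IsJointDensity.preRuin_eq (hw : IsJointDensity P c W X w) (hM : IsModel P lam f W X)
    (hc : 0 < c) {u : ℝ} (hu : 0 ≤ u) (n : ℕ) {A : Set ℝ} (hA : MeasurableSet A) :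
    preRuin P c W X u n (ruinPayoff c f u A) =
      ∫⁻ t in A ∩ Ioi 0, ENNReal.ofReal (w u (n + 1) t) := by
  rw [← hw.prob_eq u hu (n + 1) (by omega) A hA, hM.prob_ruinEvent hc hu n hA]
  rfl

lemma IsJointDensity.ae_eq (hw : IsJointDensity P c W X w) (hM : IsModel P lam f W X)
    (hc : 0 < c) {u : ℝ} (hu : 0 ≤ u) (n : ℕ) {g : ℝ → ℝ≥0∞} (hg : Measurable g)
    (h : ∀ A, MeasurableSet A →
      preRuin P c W X u n (ruinPayoff c f u A) = ∫⁻ t in Ioi 0, A.indicator g t) :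
    ∀ᵐ t ∂(volume.restrict (Ioi (0 : ℝ))), ENNReal.ofReal (w u (n + 1) t) = g t := by
  have := hw.measurable u hu (n + 1) (by omega)
  refine ae_eq_of_forall_setLIntegral_eq_of_sigmaFinite (by fun_prop) hg fun A hA _ => ?_
  rw [Measure.restrict_restrict hA, ← hw.preRuin_eq hM hc hu n hA, h A hA, lintegral_indicator hA,
    Measure.restrict_restrict hA]

theorem IsJointDensity.one_eq (hw : IsJointDensity P c W X w) (hM : IsModel P lam f W X)
    (hf : IsClaimDensity f) (hlam : 0 < lam) (hc : 0 < c) {u : ℝ} (hu : 0 ≤ u) :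
    ∀ᵐ t ∂(volume.restrict (Ioi (0 : ℝ))),
      w u 1 t = lam * Real.exp (-(lam * t)) * tail f (u + c * t) := by
  have hmt := measurable_tail hf
  have h := hw.ae_eq hM hc hu 0
    (g := fun t => ENNReal.ofReal (lam * Real.exp (-(lam * t)) * tail f (u + c * t)))
    (by fun_prop) fun A hA => by
      have hm := measurable_ruinPayoff (c := c) (f := f) u hA
      rw [hM.preRuin_zero hu hm, lintegral_expMeasure lam (by fun_prop)]
      refine lintegral_congr fun t => ?_
      by_cases ht : t ∈ A
      · simp [ruinPayoff, ht, claimLaw_Ioi hf,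
          ENNReal.ofReal_mul (show 0 ≤ lam * Real.exp (-(lam * t)) by positivity)]
      · simp [ruinPayoff, ht]
  filter_upwards [h] with t ht
  rwa [zero_add, ENNReal.ofReal_eq_ofReal_iff (hw.nonneg u hu 1 le_rfl t)
    (mul_nonneg (by positivity) (tail_nonneg hf _))] at ht

/-- Under x = c t - v the ballot factor becomes x / (c t). For n = 0 the total is v = 0, which is
the atom at x = c t; hence the closed right endpoint, and the atom's factor c cancels 1 / c. -/
lemma lintegral_gMeasure (hf : IsClaimDensity f) (hlam : 0 < lam) (hc : 0 < c) (n : ℕ) {t : ℝ}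
    (ht : 0 < t) :
    ENNReal.ofReal (lam / c) *
        ∫⁻ x in Ioc 0 (c * t), ENNReal.ofReal (tail f x) ∂(gMeasure c lam f n t) =
      ∫⁻ v, ENNReal.ofReal (lam * poissonWeight lam n t * (1 - v / (c * t))) *
        claimLaw f (Ioi (0 + c * t - v)) ∂(claimSum f n) := by
  have hmt := measurable_tail hf
  have hct : 0 < c * t := by positivity
  have hind : Measurable ((Ioc 0 (c * t)).indicator fun x => ENNReal.ofReal (tail f x)) :=
    Measurable.indicator (by fun_prop) measurableSet_Ioc
  have hml : Measurable fun v => claimLaw f (Ioi (0 + c * t - v)) :=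
    (measurable_claimLaw_Ioi f).comp (by fun_prop)
  rw [← lintegral_indicator measurableSet_Ioc]
  rcases n with _ | n
  · rw [claimSum, lintegral_dirac' _ (by fun_prop), gMeasure,
      lintegral_withDensity_eq_lintegral_mul _ (by fun_prop) hind, lintegral_smul_measure,
      lintegral_dirac' _ (Measurable.mul (by fun_prop) hind), claimLaw_Ioi hf, Pi.mul_apply,
      indicator_of_mem (by simp [hct]), smul_eq_mul, ← mul_assoc, ← mul_assoc,
      ← ENNReal.ofReal_mul (by positivity), ← ENNReal.ofReal_mul (by positivity)]
    congr 2
    · simp only [poissonWeight]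
      have : lam * (c * t) / c = lam * t := by field_simp
      rw [this]
      field_simp
      simp
    · simp
  · have hmc := hf.measurable_convPow (n := n + 1) (by omega)
    have hpw : 0 ≤ lam * poissonWeight lam (n + 1) t :=
      mul_nonneg hlam.le (poissonWeight_nonneg hlam.le _ ht.le)
    rw [lintegral_claimSum hf (by omega) (by fun_prop), gMeasure,
      lintegral_withDensity_eq_lintegral_mul _ (by fun_prop) hind,
      ← lintegral_const_mul _ (Measurable.mul (by fun_prop) hind),
      ← lintegral_indicator measurableSet_Ioo, ← lintegral_sub_left_eq_self (fun v =>
        ENNReal.ofReal (convPow f (n + 1) v) * (ENNReal.ofReal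
          (lam * poissonWeight lam (n + 1) t * (1 - v / (c * t))) *
            claimLaw f (Ioi (0 + c * t - v)))) (c * t)]
    have h0 : ∀ᵐ s : ℝ, s ≠ c * t := by simp [ae_iff]
    refine lintegral_congr_ae ?_
    filter_upwards [h0] with x hx
    rcases le_or_gt x 0 with hx0 | hx0
    · have : 1 - (c * t - x) / (c * t) ≤ 0 := by
        have : 1 - (c * t - x) / (c * t) = x / (c * t) := by field_simp; ring
        rw [this]
        exact div_nonpos_of_nonpos_of_nonneg hx0 hct.le
      rw [indicator_of_notMem (by simp [hx0]),
        ENNReal.ofReal_of_nonpos (mul_nonpos_of_nonneg_of_nonpos hpw this), zero_mul, mul_zero]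
    · rcases lt_or_gt_of_ne hx with hx1 | hx1
      · have hcp := hf.convPow_nonneg (n := n + 1) (by omega) (c * t - x)
        rw [indicator_of_mem (show x ∈ Ioo 0 (c * t) from ⟨hx0, hx1⟩), Pi.mul_apply,
          indicator_of_mem (show x ∈ Ioc 0 (c * t) from ⟨hx0, hx1.le⟩), claimLaw_Ioi hf,
          zero_add, sub_sub_cancel, ← mul_assoc, ← mul_assoc, ← ENNReal.ofReal_mul (by positivity),
          ← ENNReal.ofReal_mul hcp]
        congr 2
        simp only [poissonWeight]
        field_simp
        ring
      · rw [indicator_of_notMem (by simp [hx1.le]), hf.convPow_of_neg (by omega) (by linarith),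
          ENNReal.ofReal_zero, zero_mul]

theorem IsJointDensity.zero_capital_eq (hw : IsJointDensity P c W X w) (hM : IsModel P lam f W X)
    (hf : IsClaimDensity f) (hlam : 0 < lam) (hc : 0 < c) (n : ℕ) :
    ∀ᵐ t ∂(volume.restrict (Ioi (0 : ℝ))),
      IntegrableOn (tail f) (Ioc 0 (c * t)) (gMeasure c lam f n t) ∧
      w 0 (n + 1) t = lam / c * ∫ x in Ioc 0 (c * t), tail f x ∂(gMeasure c lam f n t) := by
  have hmt := measurable_tail hf
  have hml : Measurable fun p : ℝ × ℝ => claimLaw f (Ioi (0 + c * p.1 - p.2)) :=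
    (measurable_claimLaw_Ioi f).comp (by fun_prop)
  have h := hw.ae_eq hM hc le_rfl n
    (g := fun t => ∫⁻ v, ENNReal.ofReal (lam * poissonWeight lam n t * (1 - v / (c * t))) *
        claimLaw f (Ioi (0 + c * t - v)) ∂(claimSum f n))
    (Measurable.lintegral_prod_right' (f := fun p : ℝ × ℝ =>
      ENNReal.ofReal (lam * poissonWeight lam n p.1 * (1 - p.2 / (c * p.1))) *
        claimLaw f (Ioi (0 + c * p.1 - p.2))) (by fun_prop)) fun A hA => by
      rw [hM.preRuin_ballot hf hlam.le hc n (measurable_ruinPayoff (c := c) (f := f) 0 hA)]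
      refine lintegral_congr fun t => ?_
      by_cases ht : t ∈ A <;> simp [ruinPayoff, ht]
  filter_upwards [h, ae_restrict_mem measurableSet_Ioi] with t ht ht0
  rw [← lintegral_gMeasure hf hlam hc n ht0] at ht
  have hpos : 0 < lam / c := by positivity
  -- Finiteness is inherited from the other side of `ht`, the `ENNReal.ofReal` of a real number.
  have hfin : ∫⁻ x in Ioc 0 (c * t), ENNReal.ofReal (tail f x) ∂(gMeasure c lam f n t) ≠ ∞ := by
    intro htop
    rw [htop, ENNReal.mul_top (by simpa using hpos)] at ht
    exact ENNReal.ofReal_ne_top ht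
  have hnn : ∀ᵐ x ∂((gMeasure c lam f n t).restrict (Ioc 0 (c * t))), 0 ≤ tail f x :=
    .of_forall (tail_nonneg hf)
  refine ⟨⟨hmt.aestronglyMeasurable, ?_⟩, ?_⟩
  · rw [hasFiniteIntegral_iff_ofReal hnn]
    exact hfin.lt_top
  · rw [integral_eq_lintegral_of_nonneg_ae hnn hmt.aestronglyMeasurable,
      ← ENNReal.toReal_ofReal (hw.nonneg 0 le_rfl (n + 1) (by omega) t), ht, ENNReal.toReal_mul,
      ENNReal.toReal_ofReal hpos.le]

/-- Since u + c τ = v at the recovery time τ = (v - u) / c, the shifted payoff is the zero-capital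
payoff for the translate A - τ, whose expectation is given by w(0, m + 1, ·). The substitution v = u
+ c s and the order change t = s + r then produce the convolution in time. -/
lemma IsJointDensity.lintegral_recovery (hw : IsJointDensity P c W X w) (hM : IsModel P lam f W X)
    (hf : IsClaimDensity f) (hlam : 0 < lam) (hc : 0 < c) (u : ℝ) {j : ℕ} (hj : 1 ≤ j) (m : ℕ)
    {A : Set ℝ} (hA : MeasurableSet A) :
    ∫⁻ v, crossWeight lam j ((v - u) / c) *
        preRuin P c W X 0 m (fun p => ruinPayoff c f u A (p.1 + (v - u) / c, p.2 + v))
        ∂(claimSum f j) =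
      ∫⁻ t in A ∩ Ioi 0, recoveryDensity lam c f w u j (m + 1) t := by
  have hwm := hw.measurable 0 le_rfl (m + 1) (by omega)
  have hcm := hf.measurable_convPow hj
  have hrm := hw.measurable_recovery (lam := lam) (c := c) hf u hj (show 1 ≤ m + 1 by omega)
  have hind : Measurable (A.indicator (1 : ℝ → ℝ≥0∞)) := measurable_one.indicator hA
  have h1 : ∀ v, preRuin P c W X 0 m
      (fun p => ruinPayoff c f u A (p.1 + (v - u) / c, p.2 + v)) =
      ∫⁻ r in Ioi 0, A.indicator 1 (r + (v - u) / c) * ENNReal.ofReal (w 0 (m + 1) r) := by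
    intro v
    have hA' : MeasurableSet ((fun r => r + (v - u) / c) ⁻¹' A) := measurable_add_const _ hA
    have h2 := hw.preRuin_eq hM hc le_rfl m hA'
    rw [← Measure.restrict_restrict hA', ← lintegral_indicator hA'] at h2
    refine Eq.trans ?_ (h2.trans ?_)
    · congr 1
      ext p
      by_cases hp : p.1 + (v - u) / c ∈ A
      · simp only [ruinPayoff, indicator, hp, mem_preimage, if_true]
        congr 2
        field_simp
        ring
      · simp [ruinPayoff, indicator, hp]
    · refine lintegral_congr fun r => ?_
      by_cases hr : r + (v - u) / c ∈ A <;> simp [indicator, hr]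
  simp_rw [h1]
  rw [lintegral_claimSum hf hj (by fun_prop), lintegral_comp_affine hc u (by fun_prop),
    ← Measure.restrict_restrict hA, ← lintegral_indicator hA]
  have h3 : ∀ t, A.indicator (recoveryDensity lam c f w u j (m + 1)) t =
      ∫⁻ s in Ioo 0 t, A.indicator 1 t * (ENNReal.ofReal c *
        ENNReal.ofReal (poissonWeight lam j s * convPow f j (u + c * s) * w 0 (m + 1) (t - s))) := by
    intro t
    by_cases ht : t ∈ A <;> simp [indicator, ht, recoveryDensity]
  simp_rw [h3]
  rw [← lintegral_triangle_swap (φ := fun s t => A.indicator 1 t * (ENNReal.ofReal c *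
        ENNReal.ofReal (poissonWeight lam j s * convPow f j (u + c * s) * w 0 (m + 1) (t - s))))
      (Measurable.mul (by fun_prop) (hrm.ennreal_ofReal.const_mul _)),
    ← lintegral_indicator measurableSet_Ioi]
  refine lintegral_congr fun s => ?_
  have hs : (u + c * s - u) / c = s := by field_simp; ring
  rw [hs]
  by_cases hs0 : 0 < s
  · rw [indicator_of_mem (by exact hs0), ← lintegral_shift_Ioi s, crossWeight, if_pos hs0, ← mul_assoc,
      ← mul_assoc, ← lintegral_const_mul _ (by fun_prop)]
    refine lintegral_congr fun r => ?_
    rw [add_sub_cancel_left, ENNReal.ofReal_mul (mul_nonneg (poissonWeight_nonneg hlam.le _ hs0.le)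
      (hf.convPow_nonneg hj _)), ENNReal.ofReal_mul (poissonWeight_nonneg hlam.le _ hs0.le),
      add_comm r s]
    ring
  · simp [crossWeight, hs0]

theorem IsJointDensity.downcross_eq (hw : IsJointDensity P c W X w) (hM : IsModel P lam f W X)
    (hf : IsClaimDensity f) (hlam : 0 < lam) (hc : 0 < c) {u : ℝ} (hu : 0 ≤ u) (n : ℕ) :
    ∀ᵐ t ∂(volume.restrict (Ioi (0 : ℝ))), downcrossDensity lam c f u n t =
      ENNReal.ofReal (w u (n + 1) t) +
        ∑ j ∈ Finset.Icc 1 n, recoveryDensity lam c f w u j (n + 1 - j) t := by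
  have hwm := hw.measurable u hu (n + 1) (by omega)
  have hrm : ∀ j ∈ Finset.Icc 1 n, Measurable (recoveryDensity lam c f w u j (n + 1 - j)) := by
    intro j hj
    rw [Finset.mem_Icc] at hj
    exact hw.measurable_recoveryDensity hf u hj.1 (by omega)
  refine ae_eq_of_forall_setLIntegral_eq_of_sigmaFinite (measurable_downcrossDensity u n)
    (Measurable.add (by fun_prop) (Finset.measurable_sum _ hrm)) fun A hA _ => ?_
  rw [Measure.restrict_restrict hA, ← lintegral_downcross u n hA,
    hM.preRuin_add_lastRecovery hf hlam.le hc hu n (measurable_ruinPayoff u hA),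
    lintegral_add_left (by fun_prop), lintegral_finsetSum _ hrm, hw.preRuin_eq hM hc hu n hA]
  congr 1
  refine Finset.sum_congr rfl fun j hj => ?_
  rw [Finset.mem_Icc] at hj
  rw [hw.lintegral_recovery hM hf hlam hc u hj.1 (n - j) hA]
  congr! 3
  omega

lemma downcrossDensity_eq (hf : IsClaimDensity f) (hlam : 0 ≤ lam) (u : ℝ) {n : ℕ} (hn : 1 ≤ n)
    {t : ℝ} (ht : 0 < t) :
    downcrossDensity lam c f u n t = ENNReal.ofReal (poissonWeight lam n t) *
      ∫⁻ x in Ioo 0 (u + c * t),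
        ENNReal.ofReal (convPow f n (u + c * t - x) * (lam * tail f x)) := by
  have hmt := measurable_tail hf
  have hmc := hf.measurable_convPow hn
  have hpw := poissonWeight_nonneg hlam n ht.le
  set b := u + c * t
  have hml : Measurable fun v => claimLaw f (Ioi (b - v)) :=
    (measurable_claimLaw_Ioi f).comp (by fun_prop)
  have hite : Measurable fun v => if v ≤ b then claimLaw f (Ioi (b - v)) else 0 :=
    Measurable.ite measurableSet_Iic hml measurable_const
  rw [downcrossDensity, lintegral_claimSum hf hn (hite.const_mul _),
    ← lintegral_const_mul _ (by fun_prop), ← lintegral_indicator measurableSet_Ioo,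
    ← lintegral_sub_left_eq_self (fun v => ENNReal.ofReal (convPow f n v) *
      (ENNReal.ofReal (lam * poissonWeight lam n t) *
        if v ≤ b then claimLaw f (Ioi (b - v)) else 0)) b]
  have h0 : ∀ᵐ s : ℝ, s ≠ 0 := by simp [ae_iff]
  have hb : ∀ᵐ s : ℝ, s ≠ b := by simp [ae_iff]
  refine lintegral_congr_ae ?_
  filter_upwards [h0, hb] with x hx0 hxb
  rcases lt_or_gt_of_ne hx0 with hx0 | hx0
  · simp [indicator, hx0.not_gt, hx0.not_ge]
  · rcases lt_or_gt_of_ne hxb with hxb | hxb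
    · have hcp := hf.convPow_nonneg hn (b - x)
      rw [indicator_of_mem (show x ∈ Ioo 0 b from ⟨hx0, hxb⟩), if_pos (by linarith), sub_sub_cancel,
        claimLaw_Ioi hf, ← ENNReal.ofReal_mul (by positivity), ← ENNReal.ofReal_mul hcp,
        ← ENNReal.ofReal_mul hpw]
      congr 1
      ring
    · rw [indicator_of_notMem (by simp [hxb.le]), hf.convPow_of_neg hn (by linarith),
        ENNReal.ofReal_zero, zero_mul]

/-- The decomposition holds in [0, ∞] with a finite left side. Every summand is therefore finite,
which gives absolute convergence and allows the recovery terms to be subtracted in ℝ. -/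
theorem IsJointDensity.succ_eq (hw : IsJointDensity P c W X w) (hM : IsModel P lam f W X)
    (hf : IsClaimDensity f) (hlam : 0 < lam) (hc : 0 < c) {u : ℝ} (hu : 0 ≤ u) {n : ℕ}
    (hn : 1 ≤ n) : ∀ᵐ t ∂(volume.restrict (Ioi (0 : ℝ))),
      IntervalIntegrable (fun x => convPow f n (u + c * t - x) * (lam * tail f x)) volume 0
        (u + c * t) ∧
      (∀ j ∈ Finset.Icc 1 n, IntervalIntegrable (fun s =>
        poissonWeight lam j s * convPow f j (u + c * s) * w 0 (n + 1 - j) (t - s)) volume 0 t) ∧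
      w u (n + 1) t = poissonWeight lam n t *
          (∫ x in (0 : ℝ)..(u + c * t), convPow f n (u + c * t - x) * (lam * tail f x))
        - c * ∑ j ∈ Finset.Icc 1 n, ∫ s in (0 : ℝ)..t,
            poissonWeight lam j s * convPow f j (u + c * s) * w 0 (n + 1 - j) (t - s) := by
  have hmt := measurable_tail hf
  have hmc := hf.measurable_convPow hn
  filter_upwards [hw.downcross_eq hM hf hlam hc hu n, ae_restrict_mem measurableSet_Ioi]
    with t heq (ht : 0 < t)
  have hlt := downcrossDensity_lt_top (lam := lam) (c := c) hf u n t
  have hpw : 0 < poissonWeight lam n t := by unfold poissonWeight; positivity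
  have hsum : ∀ j ∈ Finset.Icc 1 n, recoveryDensity lam c f w u j (n + 1 - j) t ≠ ∞ := by
    rw [heq, ENNReal.add_lt_top, ENNReal.sum_lt_top] at hlt
    exact fun j hj => (hlt.2 j hj).ne
  have hrec : ∀ j ∈ Finset.Icc 1 n, IntervalIntegrable (fun s =>
        poissonWeight lam j s * convPow f j (u + c * s) * w 0 (n + 1 - j) (t - s)) volume 0 t ∧
      (recoveryDensity lam c f w u j (n + 1 - j) t).toReal = c * ∫ s in (0 : ℝ)..t,
        poissonWeight lam j s * convPow f j (u + c * s) * w 0 (n + 1 - j) (t - s) := by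
    intro j hj
    have hfin := hsum j hj
    rw [Finset.mem_Icc] at hj
    have hm : Measurable fun s =>
        poissonWeight lam j s * convPow f j (u + c * s) * w 0 (n + 1 - j) (t - s) :=
      (hw.measurable_recovery hf u hj.1 (by omega)).comp measurable_prodMk_right
    rw [recoveryDensity, lintegral_const_mul _ hm.ennreal_ofReal] at hfin ⊢
    have hfin' : ∫⁻ s in Ioo 0 t, ENNReal.ofReal
        (poissonWeight lam j s * convPow f j (u + c * s) * w 0 (n + 1 - j) (t - s)) ≠ ∞ := by
      intro htop
      rw [htop, ENNReal.mul_top (by simpa using hc)] at hfin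
      exact hfin rfl
    obtain ⟨h1, h2⟩ := intervalIntegral_of_lintegral_ne_top ht.le hm (fun s hs =>
      mul_nonneg (mul_nonneg (poissonWeight_nonneg hlam.le _ hs.le) (hf.convPow_nonneg hj.1 _))
        (hw.nonneg 0 le_rfl _ (by omega) _)) hfin'
    exact ⟨h1, by rw [h2, ENNReal.toReal_mul, ENNReal.toReal_ofReal hc.le]⟩
  have hdeq := downcrossDensity_eq (lam := lam) (c := c) hf hlam.le u hn ht
  have hdfin : ∫⁻ x in Ioo 0 (u + c * t),
      ENNReal.ofReal (convPow f n (u + c * t - x) * (lam * tail f x)) ≠ ∞ := by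
    intro htop
    rw [hdeq, htop, ENNReal.mul_top (by simpa using hpw)] at hlt
    exact lt_irrefl _ hlt
  obtain ⟨h1, h2⟩ := intervalIntegral_of_lintegral_ne_top (b := u + c * t) (by positivity)
    (by fun_prop) (fun x _ => mul_nonneg (hf.convPow_nonneg hn _)
      (mul_nonneg hlam.le (tail_nonneg hf x))) hdfin
  refine ⟨h1, fun j hj => (hrec j hj).1, ?_⟩
  have hreal := congrArg ENNReal.toReal heq
  rw [hdeq, ENNReal.toReal_mul, ENNReal.toReal_ofReal hpw.le, ← h2,
    ENNReal.toReal_add ENNReal.ofReal_ne_top (ENNReal.sum_ne_top.2 hsum),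
    ENNReal.toReal_ofReal (hw.nonneg u hu _ (by omega) t), ENNReal.toReal_sum hsum,
    Finset.sum_congr rfl fun j hj => (hrec j hj).2, ← Finset.mul_sum] at hreal
  linarith

end JointDensity

end ClassicalRisk

theorem mainTheorem7 {Ω : Type*} [MeasurableSpace Ω] (P : Measure Ω) [IsProbabilityMeasure P]
    (lam c₁ : ℝ) (hlam : 0 < lam) (hc₁ : 0 < c₁)
    (f : ℝ → ℝ) (hf : ClassicalRisk.IsClaimDensity f)
    (W X : ℕ → Ω → ℝ) (hWX : ClassicalRisk.IsModel P lam f W X) :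
    -- the events are measurable up to null sets, and the joint density exists
    (∀ u, 0 ≤ u → ∀ n, 1 ≤ n → ∀ A : Set ℝ, MeasurableSet A →
      NullMeasurableSet (ClassicalRisk.ruinEvent c₁ W X u n A) P) ∧
    (∃ w, ClassicalRisk.IsJointDensity P c₁ W X w) ∧
    -- and every version of it satisfies the formulas, for almost every `t > 0`
    ∀ w, ClassicalRisk.IsJointDensity P c₁ W X w →
      (∀ u, 0 ≤ u → ∀ᵐ t ∂(volume.restrict (Ioi (0 : ℝ))),
        w u 1 t = lam * Real.exp (-(lam * t)) * ClassicalRisk.tail f (u + c₁ * t)) ∧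
      (∀ u, 0 ≤ u → ∀ n : ℕ, 1 ≤ n → ∀ᵐ t ∂(volume.restrict (Ioi (0 : ℝ))),
        IntervalIntegrable (fun x => ClassicalRisk.convPow f n (u + c₁ * t - x) *
          (lam * ClassicalRisk.tail f x)) volume 0 (u + c₁ * t) ∧
        (∀ j ∈ Finset.Icc 1 n, IntervalIntegrable (fun s =>
          (lam * s) ^ j / j.factorial * Real.exp (-(lam * s)) *
            ClassicalRisk.convPow f j (u + c₁ * s) * w 0 (n + 1 - j) (t - s)) volume 0 t) ∧
        w u (n + 1) t =
          (lam * t) ^ n / n.factorial * Real.exp (-(lam * t)) *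
            (∫ x in (0 : ℝ)..(u + c₁ * t), ClassicalRisk.convPow f n (u + c₁ * t - x) *
              (lam * ClassicalRisk.tail f x))
          - c₁ * ∑ j ∈ Finset.Icc 1 n, ∫ s in (0 : ℝ)..t,
              (lam * s) ^ j / j.factorial * Real.exp (-(lam * s)) *
                ClassicalRisk.convPow f j (u + c₁ * s) * w 0 (n + 1 - j) (t - s)) ∧
      (∀ n : ℕ, 1 ≤ n → ∀ᵐ t ∂(volume.restrict (Ioi (0 : ℝ))),
        IntegrableOn (ClassicalRisk.tail f) (Ioc 0 (c₁ * t))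
          (ClassicalRisk.gMeasure c₁ lam f (n - 1) t) ∧
        w 0 n t = lam / c₁ * ∫ x in Ioc 0 (c₁ * t), ClassicalRisk.tail f x
          ∂(ClassicalRisk.gMeasure c₁ lam f (n - 1) t)) := by
  refine ⟨fun u hu n hn A hA => hWX.nullMeasurableSet_ruinEvent hc₁ hu hn hA,
    hWX.exists_isJointDensity hf hlam hc₁, fun w hw => ⟨fun u hu => hw.one_eq hWX hf hlam hc₁ hu,
      fun u hu n hn => hw.succ_eq hWX hf hlam hc₁ hu hn, fun n hn => ?_⟩⟩
  obtain ⟨n, rfl⟩ := Nat.exists_eq_add_of_le' hn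
  exact hw.zero_capital_eq hWX hf hlam hc₁ n
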